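/- The graph $UP$ of unordered pairs is the following $\mathbb N$-graded multigraph. Level $0$ consists of one vertex $\emptyset$; level $1$ consists of two vertices $0,1$, each joined to $\emptyset$ by one edge; for $n\ge 1$ the vertices of level $n+1$ are the unordered pairs $\{u,v\}$ of (not necessarily distinct) vertices of level $n$, and a pair $\{u,v\}$ with $u\neq v$ is joined by one edge to each of $u$ and $v$, while $\{v,v\}$ is joined to $v$ by two edges. For a graded multigraph $\Gamma$ with finite levels $\Gamma_n$ and finitely many edges between consecutive levels, with $\Gamma_0=\{\emptyset\}$, in which every vertex has a successor and every vertex except $\emptyset$ has a predecessor, let $T(\Gamma)$ be the compact space of infinite paths starting at $\emptyset$. For $x\in T(\Gamma)$ let $\xi_n(x)$ be the finite set of all paths that coincide with $x$ from level $n$ on, and let $\mu^x_n$ be the uniform probability measure on $\xi_n(x)$. A Borel probability measure $\mu$ on $T(\Gamma)$ is central if for every vertex $v$ all finite paths from $\emptyset$ to $v$ have the same $\mu$-measure (equivalently, $\mu$ is a Markov measure whose conditional measures on the paths from $\emptyset$ to $v$ are uniform). It is ergodic if every Borel set that is a union of classes $\xi_n(x)$ for every $n$ has measure $0$ or $1$.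 Let $\operatorname{Erg}(\Gamma)$ be the set of ergodic central measures. For a metric $\rho$ on $T(\Gamma)$ put $\rho_0=\rho$ and $\rho_{n+1}(x,y)=K_{\rho_n}(\mu^x_{n+1},\mu^y_{n+1})$, where $K_c(\alpha,\beta)=\inf_\psi\int c\,d\psi$ (infimum over all couplings $\psi$ of $\alpha$ and $\beta$) is the Kantorovich distance. A central measure $\mu$ is standard if it is ergodic and, for some metric $\rho$ on $T(\Gamma)$ that is Borel measurable on $T(\Gamma)\times T(\Gamma)$ and separable off a $\mu$-null set, $$\lim_{n\to\infty}\int\!\!\int\rho_n(x,y)\,d\mu(x)\,d\mu(y)=0 .$$ A telescoping of $\Gamma$ along $0=n_0<n_1<n_2<\cdots$ is the graded multigraph with levels $\Gamma_{n_k}$, $k\ge 0$, whose edges between levels $k$ and $k+1$ are the paths of $\Gamma$ between $\Gamma_{n_k}$ and $\Gamma_{n_{k+1}}$. The graph $\Gamma$ is eventually standard if there is a telescoping $\Gamma'$ of $\Gamma$ such that all measures in $\operatorname{Erg}(\Gamma')$ are standard. **Statement.** The graph $UP$ is not eventually standard: for every telescoping of $UP$ there is an ergodic central measure on its path space that is not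 standard. Moreover, the ergodic central measures of $UP$ admit no good parametrization, in the sense that ergodic measures cannot be singled out by finite approximations: for every $n$ the projection of $\operatorname{Erg}(UP)$ to level $n$ is the whole finite simplex, i.e. every probability vector $(p_v)$ on the vertices of level $n$ of $UP$ has the form $p_v=\mu\{x: x \text{ passes through } v\}$ for some $\mu\in\operatorname{Erg}(UP)$. -/

import Mathlib

open MeasureTheory Filter Topology
open scoped ENNReal

/-- An infinite `ℕ`-graded graph (Bratteli diagram) with finite levels `V n` and finite sets `E n` of
edges between the levels `n` and `n + 1`; multiple edges are allowed. The level `0` is one vertex,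
every vertex has a successor, and every vertex of positive level has a predecessor. -/
structure GradedGraph where
  V : ℕ → Type
  E : ℕ → Type
  src : ∀ n, E n → V n
  tgt : ∀ n, E n → V (n + 1)
  finite_V : ∀ n, Finite (V n)
  finite_E : ∀ n, Finite (E n)
  root : V 0
  eq_root : ∀ v : V 0, v = root
  exists_succ : ∀ n (v : V n), ∃ e : E n, src n e = v
  exists_pred : ∀ n (v : V (n + 1)), ∃ e : E n, tgt n e = v

namespace GradedGraph

variable (Γ : GradedGraph)

/-- The space `T(Γ)` of infinite paths starting at the initial vertex. -/
def Path : Type :=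
  {e : ∀ n, Γ.E n // ∀ n, Γ.tgt n (e n) = Γ.src (n + 1) (e (n + 1))}

variable {Γ}

/-- The edge of a path between the levels `n` and `n + 1`. -/
def Path.edge (x : Γ.Path) (n : ℕ) : Γ.E n := x.1 n

/-- The vertex of level `n` on a path. -/
def Path.vert (x : Γ.Path) (n : ℕ) : Γ.V n := Γ.src n (x.edge n)

/-- The `σ`-algebra generated by the edge coordinates; since the sets of edges are finite, this is the
Borel `σ`-algebra of the compact space `T(Γ)`. -/
instance : MeasurableSpace Γ.Path :=
  ⨆ n, MeasurableSpace.comap (fun x : Γ.Path => x.edge n) ⊤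

/-- The class of `x` in the partition `ξ_n`: the (finitely many) paths that coincide with `x` from
the level `n` on. -/
def tailClass (n : ℕ) (x : Γ.Path) : Set Γ.Path :=
  {y | ∀ k, n ≤ k → y.edge k = x.edge k}

/-- `A` belongs to the `n`-th `σ`-algebra of the tail filtration: it is a Borel set which contains,
with every path, all paths coinciding with it from the level `n` on. -/
def TailMeasurable (n : ℕ) (A : Set Γ.Path) : Prop :=
  MeasurableSet A ∧ ∀ x ∈ A, tailClass n x ⊆ A

/-- The cylinder of all paths whose initial segment up to the level `n` is that of `x`. -/
def cylinder (n : ℕ) (x : Γ.Path) : Set Γ.Path :=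
  {y | ∀ k, k < n → y.edge k = x.edge k}

/-- Centrality: for every vertex `v`, all finite paths joining the initial vertex with `v` have the
same measure, i.e. the conditional measure on these paths is uniform. (Applied at all levels, this also
yields the Markov property: the measure of a finite path depends on its end vertex only.) -/
def IsCentral (μ : Measure Γ.Path) : Prop :=
  ∀ (n : ℕ) (x y : Γ.Path), x.vert n = y.vert n → μ (cylinder n x) = μ (cylinder n y)

/-- Ergodicity: the tail `σ`-algebra, the intersection of the tail filtration, is trivial mod 0. -/
def IsErgodic (μ : Measure Γ.Path) : Prop :=
  ∀ A : Set Γ.Path, (∀ n, TailMeasurable n A) → μ A = 0 ∨ μ A = 1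

/-- The ergodic central probability measures on `T(Γ)`, i.e. the absolute boundary of `Γ`. -/
def Erg (Γ : GradedGraph) : Set (Measure Γ.Path) :=
  {μ | IsProbabilityMeasure μ ∧ IsCentral μ ∧ IsErgodic μ}

/-- The Kantorovich distance between `α` and `β` for the cost `c`: the infimum, over all couplings,
of the mean cost. -/
noncomputable def kantorovich {X : Type} [MeasurableSpace X] (c : X → X → ℝ≥0∞)
    (α β : Measure X) : ℝ≥0∞ :=
  ⨅ ψ : {ψ : Measure (X × X) // ψ.map Prod.fst = α ∧ ψ.map Prod.snd = β},
    ∫⁻ p, c p.1 p.2 ∂ψ.1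

/-- The conditional measure of a central measure on the class of `x` in `ξ_n`: the uniform measure
on this finite set of paths. -/
noncomputable def condMeasure (n : ℕ) (x : Γ.Path) : Measure Γ.Path :=
  ProbabilityTheory.uniformOn (tailClass n x)

/-- The iterated semimetrics `ρ_n` on `T(Γ)`: `ρ_0 = ρ`, and `ρ_{n+1}` is obtained by transferring
`ρ_n` along the partition `ξ_{n+1}`. (As `ρ_n` depends only on the classes of `ξ_n`, one may
integrate over `T(Γ)` in place of the quotient by `ξ_n`.) -/
noncomputable def iterDist (ρ : Γ.Path → Γ.Path → ℝ) : ℕ → Γ.Path → Γ.Path → ℝ≥0∞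
  | 0 => fun x y => ENNReal.ofReal (ρ x y)
  | n + 1 => fun x y =>
      kantorovich (iterDist ρ n) (condMeasure (n + 1) x) (condMeasure (n + 1) y)

/-- An admissible metric on `(X, μ)`: a metric which is measurable as a function of two variables and
is separable after removing a null set. -/
structure IsAdmissibleMetric {X : Type} [MeasurableSpace X] (μ : Measure X) (ρ : X → X → ℝ) :
    Prop where
  measurable : Measurable (fun p : X × X => ρ p.1 p.2)
  eq_zero_iff : ∀ x y, ρ x y = 0 ↔ x = y
  symm : ∀ x y, ρ x y = ρ y x
  triangle : ∀ x y z, ρ x z ≤ ρ x y + ρ y z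
  separable : ∃ D : Set X, D.Countable ∧ ∀ᵐ x ∂μ, ∀ ε > 0, ∃ d ∈ D, ρ x d < ε

/-- Standardness of (the tail filtration of) a central measure `μ`: `μ` is ergodic and, for some initial
admissible metric, the space `(T(Γ), ρ_n, μ)` collapses to a point as `n → ∞`. -/
def IsStandard (μ : Measure Γ.Path) : Prop :=
  IsErgodic μ ∧ ∃ ρ : Γ.Path → Γ.Path → ℝ, IsAdmissibleMetric μ ρ ∧
    Tendsto (fun n => ∫⁻ x, ∫⁻ y, iterDist ρ n x y ∂μ ∂μ) atTop (𝓝 0)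

variable (Γ)

/-- The finite paths of `Γ` that start at level `i` and consist of `m + 1` edges. -/
def Segment (i m : ℕ) : Type :=
  {e : ∀ j : Fin (m + 1), Γ.E (i + j) //
    ∀ j : Fin m, Γ.tgt (i + j) (e j.castSucc) = Γ.src (i + j + 1) (e j.succ)}

variable {Γ}

/-- The initial vertex of a finite path. -/
def Segment.start {i m : ℕ} (p : Γ.Segment i m) : Γ.V i := Γ.src i (p.1 0)

/-- The final vertex of a finite path. -/
def Segment.finish {i m : ℕ} (p : Γ.Segment i m) : Γ.V (i + m + 1) :=
  Γ.tgt (i + m) (p.1 (Fin.last m))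

theorem Segment.exists_start (i m : ℕ) (v : Γ.V i) : ∃ p : Γ.Segment i m, p.start = v := by
  choose s hs using Γ.exists_succ
  let g : ∀ j : ℕ, Γ.E (i + j) := fun j =>
    Nat.rec (motive := fun j => Γ.E (i + j)) (s i v) (fun j e => s (i + j + 1) (Γ.tgt (i + j) e)) j
  exact ⟨⟨fun j => g j, fun j => (hs _ _).symm⟩, hs i v⟩

theorem Segment.exists_finish (i m : ℕ) (v : Γ.V (i + m + 1)) :
    ∃ p : Γ.Segment i m, p.finish = v := by
  induction m with
  | zero =>
    obtain ⟨e, he⟩ := Γ.exists_pred i v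
    refine ⟨⟨fun j => Fin.cases (motive := fun j : Fin 1 => Γ.E (i + j)) e
      (fun j => j.elim0) j, fun j => j.elim0⟩, he⟩
  | succ m ih =>
    obtain ⟨e, he⟩ := Γ.exists_pred (i + (m + 1)) v
    obtain ⟨p, hp⟩ := ih (Γ.src (i + (m + 1)) e)
    refine ⟨⟨fun j => Fin.lastCases (motive := fun j : Fin (m + 2) => Γ.E (i + j)) e
      (fun j => p.1 j) j, fun j => ?_⟩, ?_⟩
    · induction j using Fin.lastCases with
      | last =>
        have h := Fin.lastCases_castSucc (motive := fun j : Fin (m + 2) => Γ.E (i + j))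
          (last := e) (cast := fun j => p.1 j) (Fin.last m)
        have h' := Fin.lastCases_last (motive := fun j : Fin (m + 2) => Γ.E (i + j))
          (last := e) (cast := fun j => p.1 j)
        exact (congrArg (Γ.tgt (i + m)) h).trans
          (hp.trans (congrArg (Γ.src (i + (m + 1))) h').symm)
      | cast j =>
        have h := Fin.lastCases_castSucc (motive := fun j : Fin (m + 2) => Γ.E (i + j))
          (last := e) (cast := fun j => p.1 j) j.castSucc
        have h' := Fin.lastCases_castSucc (motive := fun j : Fin (m + 2) => Γ.E (i + j))
          (last := e) (cast := fun j => p.1 j) j.succ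
        exact (congrArg (Γ.tgt (i + j)) h).trans
          ((p.2 j).trans (congrArg (Γ.src (i + j + 1)) h').symm)
    · have h' := Fin.lastCases_last (motive := fun j : Fin (m + 2) => Γ.E (i + j))
          (last := e) (cast := fun j => p.1 j)
      exact (congrArg (Γ.tgt (i + (m + 1))) h').trans he

/-- The levels kept by a telescoping that removes `d k` levels between the `k`-th and the `(k+1)`-st
level that it keeps. Every strictly increasing sequence `0 = n_0 < n_1 < n_2 < ⋯` is of this form,
for exactly one `d`. -/
def keptLevel (d : ℕ → ℕ) : ℕ → ℕ
  | 0 => 0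
  | k + 1 => keptLevel d k + d k + 1

variable (Γ)

/-- The telescoping of `Γ` along the levels `keptLevel d k`: the other levels are removed, and the edges
between consecutive kept levels are the paths of `Γ` connecting them. -/
def telescope (d : ℕ → ℕ) : GradedGraph where
  V k := Γ.V (keptLevel d k)
  E k := Γ.Segment (keptLevel d k) (d k)
  src _ p := p.start
  tgt _ p := p.finish
  finite_V k := Γ.finite_V _
  finite_E k := by
    have := Γ.finite_E
    unfold Segment
    infer_instance
  root := Γ.root
  eq_root := Γ.eq_root
  exists_succ k v := Segment.exists_start _ _ v
  exists_pred k v := Segment.exists_finish _ _ v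

/-- `Γ` is eventually standard: some telescoping makes all ergodic central measures standard. -/
def EventuallyStandard : Prop :=
  ∃ d : ℕ → ℕ, ∀ μ ∈ Erg (Γ.telescope d), IsStandard μ

end GradedGraph

/-- The vertices of the graph of unordered pairs: the initial vertex; two vertices of level `1`; the
vertices of each further level are the unordered pairs of (not necessarily distinct) vertices of the
preceding level. -/
def UPVertex : ℕ → Type
  | 0 => Unit
  | 1 => Bool
  | n + 2 => Sym2 (UPVertex (n + 1))

/-- The edges of the graph of unordered pairs: one edge from the initial vertex to each vertex of level
`1`; an edge from `u` to a pair `p` whenever `u ∈ p`, which is doubled if `p` is a pair `{v, v}` (the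
third component tells the two copies apart). -/
def UPEdge : ℕ → Type
  | 0 => Bool
  | n + 1 => {t : UPVertex (n + 1) × Sym2 (UPVertex (n + 1)) × Bool //
      t.1 ∈ t.2.1 ∧ (t.2.2 = true → t.2.1.IsDiag)}

def upSrc : ∀ n, UPEdge n → UPVertex n
  | 0, _ => ()
  | _ + 1, t => t.1.1

def upTgt : ∀ n, UPEdge n → UPVertex (n + 1)
  | 0, b => b
  | _ + 1, t => t.1.2.1

theorem finite_UPVertex : ∀ n, Finite (UPVertex n)
  | 0 => inferInstanceAs (Finite Unit)
  | 1 => inferInstanceAs (Finite Bool)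
  | n + 2 => by
    have := finite_UPVertex (n + 1)
    exact inferInstanceAs (Finite (Sym2 (UPVertex (n + 1))))

/-- The graph `UP` of unordered pairs. -/
def UP : GradedGraph where
  V := UPVertex
  E := UPEdge
  src := upSrc
  tgt := upTgt
  finite_V := finite_UPVertex
  finite_E
    | 0 => inferInstanceAs (Finite Bool)
    | n + 1 => by
      have := finite_UPVertex (n + 1)
      unfold UPEdge
      infer_instance
  root := ()
  eq_root _ := rfl
  exists_succ
    | 0, _ => ⟨true, rfl⟩
    | _ + 1, v => ⟨⟨(v, s(v, v), false), by simp⟩, rfl⟩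
  exists_pred
    | 0, b => ⟨b, rfl⟩
    | n + 1, p => by
      induction p using Sym2.ind with
      | _ u v => exact ⟨⟨(u, s(u, v), false), by simp⟩, rfl⟩

/-! Give the leaves of a binary tree independent random labels and read the tree as a vertex: from
level `k₀` on, a tree encodes the pair of the vertices encoded by its two subtrees, while up to `k₀`
only the leftmost label counts. A uniformly chosen edge into `{u, v}` comes from `u` or `v` with
probability 1/2 each, and both subtrees have the law of a random tree one level lower. The laws of
the encoded vertices are therefore consistent and define a central measure
(`IsJoin.exists_measure`), whose distribution on level `k₀` can be prescribed freely.

It is ergodic (`IsJoin.isErgodic`): if a function of the level-`n` vertex has mean zero, its average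
over the edges into a vertex of level `n + 1` is the mean of two independent centred variables, so
its second moment is halved. Integrals over a tail set are unchanged by this averaging, hence they
vanish, and a tail set is independent of all cylinders, thus of itself. With the vertices of level
`n` as labels this gives the claim on simplices.

For three equally likely labels the measure is not standard. The choice of metric is immaterial in
the needed direction: standardness makes the iterated distances that start from the discrete
semimetric of any finite-valued measurable function collapse
(`IsStandard.eventually_lintegral_iterDist_le`). For the function "vertex of level `k₀`" they are
bounded below by `treeDist`, which compares trees by the better of the two matchings of their
subtrees (`le_kantorovich_of_pairs`). If `X(c)` is the mean of `exp (-c * treeDist)` for two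
independent trees, one level more gives `X'(2c) ≤ 2 X(c)²`, since each matching factorizes by
independence. As `2 X(3) ≤ 5/6` at the start, the mean distance stays at least 1/18
(`one_div_le_sum_weight_treeDist`).

A telescoping of `UP` has the same structure: form `{u, v}`, then go up through diagonal pairs; half
of the paths to the resulting vertex come from `u`, half from `v`. `IsJoin` isolates this property,
so that one argument covers `UP` and all its telescopings. -/

open scoped NNReal

/-! ### Paths: cylinders, tail classes, splicing, measurability. -/

namespace GradedGraph

variable {Γ : GradedGraph}

instance (n : ℕ) : Finite (Γ.V n) := Γ.finite_V n
instance (n : ℕ) : Finite (Γ.E n) := Γ.finite_E n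
instance (n : ℕ) : MeasurableSpace (Γ.V n) := ⊤
instance (n : ℕ) : MeasurableSpace (Γ.E n) := ⊤
instance (n : ℕ) : DiscreteMeasurableSpace (Γ.V n) := ⟨fun _ => trivial⟩
instance (n : ℕ) : DiscreteMeasurableSpace (Γ.E n) := ⟨fun _ => trivial⟩

theorem Path.tgt_edge (x : Γ.Path) (n : ℕ) : Γ.tgt n (x.edge n) = x.vert (n + 1) := x.2 n

theorem Path.ext {x y : Γ.Path} (h : ∀ n, x.edge n = y.edge n) : x = y :=
  Subtype.ext (funext h)

theorem Path.vert_eq_of_edge_eq {x y : Γ.Path} {n : ℕ} (h : x.edge n = y.edge n) :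
    x.vert n = y.vert n := congrArg (Γ.src n) h

theorem self_mem_cylinder (n : ℕ) (x : Γ.Path) : x ∈ cylinder n x := fun _ _ => rfl

theorem self_mem_tailClass (n : ℕ) (x : Γ.Path) : x ∈ tailClass n x := fun _ _ => rfl

theorem vert_eq_of_mem_tailClass {n k : ℕ} {x y : Γ.Path} (h : y ∈ tailClass n x) (hk : n ≤ k) :
    y.vert k = x.vert k :=
  Path.vert_eq_of_edge_eq (h k hk)

theorem vert_eq_of_mem_cylinder {n k : ℕ} {x y : Γ.Path} (h : y ∈ cylinder n x) (hk : k ≤ n) :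
    y.vert k = x.vert k := by
  cases k with
  | zero => exact (Γ.eq_root _).trans (Γ.eq_root _).symm
  | succ k => rw [← Path.tgt_edge, ← Path.tgt_edge, h k hk]

theorem cylinder_eq_of_mem {n : ℕ} {x y : Γ.Path} (h : y ∈ cylinder n x) :
    cylinder n y = cylinder n x := by
  ext z
  exact ⟨fun hz k hk => (hz k hk).trans (h k hk), fun hz k hk => (hz k hk).trans (h k hk).symm⟩

theorem cylinder_anti {m n : ℕ} (h : m ≤ n) (x : Γ.Path) : cylinder n x ⊆ cylinder m x :=
  fun _ hy k hk => hy k (hk.trans_le h)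

theorem measurable_edge (n : ℕ) : Measurable (fun x : Γ.Path => x.edge n) :=
  Measurable.of_comap_le (le_iSup (fun n => MeasurableSpace.comap (fun x : Γ.Path => x.edge n) ⊤) n)

theorem measurable_vert (n : ℕ) : Measurable (fun x : Γ.Path => x.vert n) :=
  (Measurable.of_discrete (f := Γ.src n)).comp (measurable_edge n)

theorem measurable_path_iff {X : Type*} [MeasurableSpace X] {g : X → Γ.Path} :
    Measurable g ↔ ∀ n, Measurable fun a => (g a).edge n := by
  refine ⟨fun h n => (measurable_edge n).comp h, fun h => ?_⟩
  rw [measurable_iff_comap_le]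
  simp only [instMeasurableSpacePath, MeasurableSpace.comap_iSup, MeasurableSpace.comap_comp]
  exact iSup_le fun n => (h n).comap_le

theorem measurableSet_cylinder (n : ℕ) (x : Γ.Path) : MeasurableSet (cylinder n x) := by
  have : cylinder n x = ⋂ k, ⋂ (_ : k < n), {y : Γ.Path | y.edge k = x.edge k} := by
    ext y; simp [cylinder]
  rw [this]
  exact MeasurableSet.iInter fun k => MeasurableSet.iInter fun _ =>
    measurable_edge k (MeasurableSet.of_discrete (s := {x.edge k}))

theorem measurableSet_vert (n : ℕ) (s : Set (Γ.V n)) :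
    MeasurableSet {x : Γ.Path | x.vert n ∈ s} :=
  measurable_vert n (MeasurableSet.of_discrete (s := s))

theorem measurableSet_edge (n : ℕ) (s : Set (Γ.E n)) :
    MeasurableSet {x : Γ.Path | x.edge n ∈ s} :=
  measurable_edge n (MeasurableSet.of_discrete (s := s))

instance : StandardBorelSpace Γ.Path := by
  have hr : MeasurableSet {e : ∀ n, Γ.E n | ∀ n, Γ.tgt n (e n) = Γ.src (n + 1) (e (n + 1))} := by
    rw [Set.ofPred_forall]
    exact MeasurableSet.iInter fun n => measurableSet_eq_fun
      ((Measurable.of_discrete (f := Γ.tgt n)).comp (measurable_pi_apply n))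
      ((Measurable.of_discrete (f := Γ.src (n + 1))).comp (measurable_pi_apply (n + 1)))
  have hi : (instMeasurableSpacePath : MeasurableSpace Γ.Path)
      = MeasurableSpace.comap Subtype.val MeasurableSpace.pi := by
    simp only [MeasurableSpace.pi, MeasurableSpace.comap_iSup, MeasurableSpace.comap_comp]
    rfl
  rw [hi]
  exact hr.standardBorel

/-- The path with given edges. -/
def Path.ofEdges (e : ∀ n, Γ.E n) (he : ∀ n, Γ.tgt n (e n) = Γ.src (n + 1) (e (n + 1))) :
    Γ.Path := ⟨e, he⟩

theorem Path.edge_ofEdges (e : ∀ n, Γ.E n) (he) (n : ℕ) : (Path.ofEdges e he).edge n = e n := rfl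

/-- Choices of a successor edge for every vertex. -/
abbrev Choice (Γ : GradedGraph) : Type :=
  ∀ i : Σ n, Γ.V n, {e : Γ.E i.1 // Γ.src i.1 e = i.2}

/-- The vertices of the path that obeys a choice of successor edges. -/
def followVert (s : Γ.Choice) : ∀ n, Γ.V n
  | 0 => Γ.root
  | n + 1 => Γ.tgt n (s ⟨n, followVert s n⟩).1

/-- The path that obeys a choice of successor edges. -/
def follow (s : Γ.Choice) : Γ.Path :=
  ⟨fun n => (s ⟨n, followVert s n⟩).1, fun n => (s ⟨n + 1, followVert s (n + 1)⟩).2.symm⟩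

theorem follow_edge (s : Γ.Choice) (n : ℕ) :
    (follow s).edge n = (s ⟨n, (follow s).vert n⟩).1 := by
  have h : (follow s).vert n = followVert s n := (s ⟨n, followVert s n⟩).2
  rw [h]; rfl

theorem follow_mem_cylinder (s : Γ.Choice) (n : ℕ) (x : Γ.Path) :
    follow s ∈ cylinder n x ↔ ∀ k < n, (s ⟨k, x.vert k⟩).1 = x.edge k := by
  induction n with
  | zero => simp [cylinder]
  | succ n ih =>
    constructor
    · intro h k hk
      rw [← h k hk, ← vert_eq_of_mem_cylinder h hk.le, follow_edge]
    · intro h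
      have h' := ih.2 fun k hk => h k (hk.trans n.lt_succ_self)
      intro k hk
      rcases Nat.lt_succ_iff_lt_or_eq.1 hk with hk | rfl
      · exact h' k hk
      · rw [follow_edge, vert_eq_of_mem_cylinder h' le_rfl, h k k.lt_succ_self]

/-- Follow the choice that takes the prescribed edge wherever it starts at the current vertex, and
an arbitrary successor elsewhere. -/
theorem exists_path_of_segment (n : ℕ) (g : ∀ k, Γ.E k)
    (hg : ∀ k < n, Γ.tgt k (g k) = Γ.src (k + 1) (g (k + 1))) :
    ∃ y : Γ.Path, ∀ k ≤ n, y.edge k = g k := by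
  classical
  choose t ht using Γ.exists_succ
  let s : Γ.Choice := fun i =>
    if h : Γ.src i.1 (g i.1) = i.2 then ⟨g i.1, h⟩ else ⟨t i.1 i.2, ht i.1 i.2⟩
  have key : ∀ k, (follow s).vert k = Γ.src k (g k) → (follow s).edge k = g k := by
    intro k hk
    rw [follow_edge, hk]
    simp [s]
  refine ⟨follow s, fun k => ?_⟩
  induction k with
  | zero => exact fun _ => key 0 ((Γ.eq_root _).trans (Γ.eq_root _).symm)
  | succ k ih =>
    intro hk
    apply key
    rw [← Path.tgt_edge, ih (by omega), hg k hk]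

/-- A path can be continued from any level with any admissible edge. -/
theorem exists_mem_cylinder_edge_eq (x : Γ.Path) (n : ℕ) (e : Γ.E n) (he : Γ.src n e = x.vert n) :
    ∃ y ∈ cylinder n x, y.edge n = e := by
  obtain ⟨y, hy⟩ := exists_path_of_segment n (Function.update x.edge n e) (by
    intro k hk
    rw [Function.update_of_ne hk.ne]
    rcases Nat.lt_or_eq_of_le (Nat.succ_le_of_lt hk) with h | h
    · rw [Function.update_of_ne h.ne]; exact x.tgt_edge k
    · subst h
      rw [Function.update_self, he]; exact x.tgt_edge k)
  refine ⟨y, fun k hk => ?_, ?_⟩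
  · rw [hy k hk.le, Function.update_of_ne hk.ne]
  · rw [hy n le_rfl, Function.update_self]

theorem exists_path_vert (n : ℕ) (v : Γ.V n) : ∃ x : Γ.Path, x.vert n = v := by
  induction n with
  | zero =>
    choose t ht using Γ.exists_succ
    exact ⟨follow fun i => ⟨t i.1 i.2, ht i.1 i.2⟩, (Γ.eq_root _).trans (Γ.eq_root _).symm⟩
  | succ n ih =>
    obtain ⟨e, he⟩ := Γ.exists_pred n v
    obtain ⟨x, hx⟩ := ih (Γ.src n e)
    obtain ⟨y, -, hy⟩ := exists_mem_cylinder_edge_eq x n e hx.symm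
    exact ⟨y, by rw [← Path.tgt_edge, hy, he]⟩

instance : Nonempty Γ.Path := ⟨(exists_path_vert 0 Γ.root).choose⟩

open Classical in
/-- The path that follows `y` up to the level `n` and `z` from there on, if they meet on this level;
`z` otherwise. -/
noncomputable def splice (n : ℕ) (y z : Γ.Path) : Γ.Path :=
  if h : y.vert n = z.vert n then
    Path.ofEdges (fun k => if k < n then y.edge k else z.edge k) (by
      intro k
      rcases lt_trichotomy (k + 1) n with hk | hk | hk
      · simp only [if_pos hk, if_pos (show k < n by omega)]; exact y.2 k
      · subst hk
        simp only [k.lt_succ_self, lt_irrefl, if_true, if_false]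
        rw [y.tgt_edge, h]; rfl
      · simp only [if_neg (show ¬ k < n by omega), if_neg (show ¬ k + 1 < n by omega)]; exact z.2 k)
  else z

theorem splice_edge_of_le {n k : ℕ} (y z : Γ.Path) (hk : n ≤ k) :
    (splice n y z).edge k = z.edge k := by
  unfold splice
  split_ifs with h
  · rw [Path.edge_ofEdges, if_neg hk.not_gt]
  · rfl

theorem splice_edge_of_lt {n k : ℕ} {y z : Γ.Path} (h : y.vert n = z.vert n) (hk : k < n) :
    (splice n y z).edge k = y.edge k := by
  unfold splice
  rw [dif_pos h, Path.edge_ofEdges, if_pos hk]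

theorem splice_vert_of_le {n k : ℕ} (y z : Γ.Path) (hk : n ≤ k) :
    (splice n y z).vert k = z.vert k :=
  Path.vert_eq_of_edge_eq (splice_edge_of_le y z hk)

theorem splice_mem_tailClass (n : ℕ) (y z : Γ.Path) : splice n y z ∈ tailClass n z :=
  fun _ hk => splice_edge_of_le y z hk

open Classical in
theorem measurable_splice (n : ℕ) (y : Γ.Path) : Measurable (splice n y) := by
  rw [measurable_path_iff]
  intro k
  rcases le_or_gt n k with hk | hk
  · simp only [splice_edge_of_le _ _ hk]; exact measurable_edge k
  · have : (fun z => (splice n y z).edge k)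
        = fun z : Γ.Path => if z.vert n = y.vert n then y.edge k else z.edge k := by
      ext z
      split_ifs with h
      · exact splice_edge_of_lt h.symm hk
      · unfold splice
        rw [dif_neg (Ne.symm h)]
    rw [this]
    exact Measurable.ite (measurableSet_vert n {y.vert n}) measurable_const (measurable_edge k)

theorem follow_edge_preimage (n : ℕ) (e : Γ.E n) :
    (fun s : Γ.Choice => (follow s).edge n) ⁻¹' {e}
      = {s | (follow s).vert n = Γ.src n e} ∩ {s | (s ⟨n, Γ.src n e⟩).1 = e} := by
  ext s
  simp only [Set.mem_preimage, Set.mem_singleton_iff, Set.mem_inter_iff, Set.mem_ofPred_eq]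
  constructor
  · rintro h
    have h' : (follow s).vert n = Γ.src n e := by rw [← h]; rfl
    exact ⟨h', by rw [← h', ← follow_edge, h]⟩
  · rintro ⟨h1, h2⟩
    rw [follow_edge, h1, h2]

/-- Vertices and edges are handled alternately: the edge of level `n` is determined by the vertex of
level `n` and one coordinate of the choice, and it determines the next vertex. -/
theorem measurable_follow : Measurable (follow : Γ.Choice → Γ.Path) := by
  have aux : ∀ n, (Measurable fun s : Γ.Choice => (follow s).vert n) →
      Measurable fun s : Γ.Choice => (follow s).edge n := by
    intro n hn
    refine measurable_to_countable' fun e => ?_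
    rw [follow_edge_preimage]
    exact (hn (MeasurableSet.of_discrete (s := {Γ.src n e}))).inter
      (measurable_subtype_coe.comp (measurable_pi_apply (⟨n, Γ.src n e⟩ : Σ n, Γ.V n))
        (MeasurableSet.of_discrete (s := {e})))
  have h : ∀ n, Measurable fun s : Γ.Choice => (follow s).vert n := by
    intro n
    induction n with
    | zero =>
      have : (fun s : Γ.Choice => (follow s).vert 0) = fun _ => Γ.root :=
        funext fun s => Γ.eq_root _
      rw [this]; exact measurable_const
    | succ n ih =>
      simp only [← Path.tgt_edge]
      exact (Measurable.of_discrete (f := Γ.tgt n)).comp (aux n ih)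
  exact measurable_path_iff.2 fun n => aux n (h n)

end GradedGraph

/-! ### Central measures from harmonic functions; exchange of initial segments; size of tail
classes. -/

namespace GradedGraph

variable {Γ : GradedGraph}

noncomputable instance (n : ℕ) : Fintype (Γ.V n) := Fintype.ofFinite _
noncomputable instance (n : ℕ) : Fintype (Γ.E n) := Fintype.ofFinite _
noncomputable instance (n : ℕ) : DecidableEq (Γ.V n) := Classical.decEq _
noncomputable instance (n : ℕ) : DecidableEq (Γ.E n) := Classical.decEq _
noncomputable instance : DecidableEq Γ.Path := Classical.decEq _

/-- A normalized harmonic function on the vertices defines a measure on the space of paths. -/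
theorem exists_measure_cylinder_eq (φ : ∀ n, Γ.V n → ℝ≥0∞) (h0 : φ 0 Γ.root = 1)
    (hφ : ∀ n v, ∑ e with Γ.src n e = v, φ (n + 1) (Γ.tgt n e) = φ n v) :
    ∃ μ : Measure Γ.Path, IsProbabilityMeasure μ ∧ ∀ n x, μ (cylinder n x) = φ n (x.vert n) := by
  classical
  have hle : ∀ n (e : Γ.E n), φ (n + 1) (Γ.tgt n e) ≤ φ n (Γ.src n e) := fun n e => by
    rw [← hφ n (Γ.src n e)]
    exact Finset.single_le_sum (f := fun e => φ (n + 1) (Γ.tgt n e)) (fun _ _ => zero_le)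
      (by simp)
  have htop : ∀ n v, φ n v ≠ ∞ := by
    intro n
    induction n with
    | zero => intro v; rw [Γ.eq_root v, h0]; exact ENNReal.one_ne_top
    | succ n ih =>
      intro v
      obtain ⟨e, rfl⟩ := Γ.exists_pred n v
      exact ne_top_of_le_ne_top (ih _) (hle n e)
  have hsum : ∀ n v, ∑' e : {e : Γ.E n // Γ.src n e = v}, φ (n + 1) (Γ.tgt n e.1) = φ n v := by
    intro n v
    rw [tsum_fintype, ← hφ n v]
    exact (Finset.sum_subtype _ (by simp) fun e => φ (n + 1) (Γ.tgt n e)).symm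
  choose t ht using Γ.exists_succ
  -- Transition probabilities of the Markov chain. Where `φ` vanishes any law will do, because `φ`
  -- then vanishes at all successors too.
  have hq : ∀ i : Σ n, Γ.V n, ∃ q : PMF {e : Γ.E i.1 // Γ.src i.1 e = i.2},
      ∀ e, φ i.1 i.2 * q e = φ (i.1 + 1) (Γ.tgt i.1 e.1) := by
    rintro ⟨n, v⟩
    by_cases hv : φ n v = 0
    · refine ⟨PMF.pure ⟨t n v, ht n v⟩, fun e => ?_⟩
      have := hle n e.1
      rw [e.2] at this
      simp only [hv, zero_mul] at this ⊢
      exact (le_antisymm this zero_le).symm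
    · refine ⟨PMF.normalize (fun e => φ (n + 1) (Γ.tgt n e.1)) (by rwa [hsum])
        (by rw [hsum]; exact htop n v), fun e => ?_⟩
      rw [PMF.normalize_apply, hsum, mul_comm, mul_assoc, ENNReal.inv_mul_cancel hv (htop n v),
        mul_one]
  choose q hq using hq
  -- Successors are drawn independently at all vertices in advance. A path meets each level once, so
  -- a cylinder pulls back to a finite box and its measure is a product of transition probabilities,
  -- which telescopes to `φ`.
  let P : Measure Γ.Choice := Measure.infinitePi fun i => (q i).toMeasure
  refine ⟨P.map follow, Measure.isProbabilityMeasure_map measurable_follow.aemeasurable,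
    fun n x => ?_⟩
  have hprod : P.map follow (cylinder n x)
      = ∏ k ∈ Finset.range n, q ⟨k, x.vert k⟩ ⟨x.edge k, rfl⟩ := by
    rw [Measure.map_apply measurable_follow (measurableSet_cylinder n x)]
    have hinj : Function.Injective fun k => (⟨k, x.vert k⟩ : Σ n, Γ.V n) :=
      fun a b h => congrArg Sigma.fst h
    have : follow ⁻¹' cylinder n x = Set.pi ((Finset.range n).map ⟨_, hinj⟩ : Finset (Σ n, Γ.V n))
        fun i => {e | e.1 = x.edge i.1} := by
      ext s
      rw [Set.mem_preimage, follow_mem_cylinder]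
      simp [Set.pi]
    rw [this, Measure.infinitePi_pi _ fun _ _ => MeasurableSet.of_discrete, Finset.prod_map]
    refine Finset.prod_congr rfl fun k _ => ?_
    rw [← PMF.toMeasure_apply_singleton _ _ MeasurableSet.of_discrete]
    congr 1
    ext e
    exact ⟨fun h => Subtype.ext h, fun h => congrArg Subtype.val h⟩
  rw [hprod]
  clear hprod
  induction n with
  | zero => rw [Γ.eq_root (x.vert 0), h0]; simp
  | succ n ih => rw [Finset.prod_range_succ, ih, hq ⟨n, x.vert n⟩, x.tgt_edge]

theorem finite_range_cylinder (n : ℕ) : (Set.range (cylinder n : Γ.Path → Set Γ.Path)).Finite :=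
  (Set.finite_range fun p : ∀ k : Fin n, Γ.E k => {y : Γ.Path | ∀ k (hk : k < n),
    y.edge k = p ⟨k, hk⟩}).subset (by rintro _ ⟨x, rfl⟩; exact ⟨fun k => x.edge k, rfl⟩)

/-- The cylinders from the level `n` on. -/
def cylindersFrom (Γ : GradedGraph) (n : ℕ) : Set (Set Γ.Path) :=
  {s | ∃ m, n ≤ m ∧ ∃ z, s = cylinder m z}

theorem isPiSystem_cylindersFrom (n : ℕ) : IsPiSystem (Γ.cylindersFrom n) := by
  rintro _ ⟨m, hm, z, rfl⟩ _ ⟨m', hm', z', rfl⟩ ⟨w, hw, hw'⟩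
  refine ⟨max m m', le_max_of_le_left hm, w, ?_⟩
  rw [← cylinder_eq_of_mem hw, ← cylinder_eq_of_mem hw']
  ext y
  simp only [cylinder, lt_max_iff, Set.mem_inter_iff, Set.mem_ofPred_eq]
  exact ⟨fun h k hk => hk.elim (h.1 k) (h.2 k), fun h => ⟨fun k hk => h k (.inl hk),
    fun k hk => h k (.inr hk)⟩⟩

/-- An event on one edge is a finite union of cylinders of any sufficiently high level. Starting at
level `n` matters: the laws constructed below are explicit only from `k₀` on. -/
theorem generateFrom_cylindersFrom (n : ℕ) :
    (inferInstance : MeasurableSpace Γ.Path) = MeasurableSpace.generateFrom (Γ.cylindersFrom n) := by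
  apply le_antisymm
  · refine iSup_le fun k => ?_
    rintro _ ⟨s, -, rfl⟩
    have : (fun x : Γ.Path => x.edge k) ⁻¹' s
        = ⋃₀ {c ∈ Set.range (cylinder (max n (k + 1))) | c ⊆ (fun x : Γ.Path => x.edge k) ⁻¹' s} := by
      apply Set.Subset.antisymm
      · intro x hx
        refine ⟨_, ⟨⟨x, rfl⟩, fun y hy => ?_⟩, self_mem_cylinder _ x⟩
        rw [Set.mem_preimage, hy k (lt_max_of_lt_right k.lt_succ_self)]
        exact hx
      · exact Set.sUnion_subset fun c hc => hc.2
    rw [this]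
    refine @MeasurableSet.sUnion _ (_) _ ((finite_range_cylinder _).subset fun _ h => h.1).countable ?_
    rintro _ ⟨⟨z, rfl⟩, -⟩
    exact MeasurableSpace.measurableSet_generateFrom ⟨_, le_max_left _ _, z, rfl⟩
  · refine MeasurableSpace.generateFrom_le ?_
    rintro _ ⟨m, -, z, rfl⟩
    exact measurableSet_cylinder m z

theorem splice_preimage_inter {n m : ℕ} {y y' z : Γ.Path} (hm : n ≤ m)
    (h : y.vert n = y'.vert n) (hz : z ∈ cylinder n y) :
    splice n y ⁻¹' cylinder m z ∩ cylinder n y' = cylinder m (splice n y' z) := by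
  have hv : y'.vert n = z.vert n := h.symm.trans (vert_eq_of_mem_cylinder hz le_rfl).symm
  ext t
  constructor
  · rintro ⟨h1, h2⟩ k hk
    rcases lt_or_ge k n with hkn | hkn
    · rw [splice_edge_of_lt hv hkn, h2 k hkn]
    · rw [splice_edge_of_le _ _ hkn, ← h1 k hk, splice_edge_of_le _ _ hkn]
  · intro ht
    have h2 : t ∈ cylinder n y' := fun k hk => by
      rw [ht k (hk.trans_le hm), splice_edge_of_lt hv hk]
    refine ⟨fun k hk => ?_, h2⟩
    rcases lt_or_ge k n with hkn | hkn
    · rw [splice_edge_of_lt (h.trans (vert_eq_of_mem_cylinder h2 le_rfl).symm) hkn, hz k hkn]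
    · rw [splice_edge_of_le _ _ hkn, ht k hk, splice_edge_of_le _ _ hkn]

/-- Centrality as an invariance: exchanging initial segments with a common end preserves the
measure. On cylinders from level `n` on, both sides are measures of cylinders with the same end
vertex. -/
theorem IsCentral.map_splice {μ : Measure Γ.Path} [IsFiniteMeasure μ] (hμ : IsCentral μ) {n : ℕ}
    {y y' : Γ.Path} (h : y.vert n = y'.vert n) :
    (μ.restrict (cylinder n y')).map (splice n y) = μ.restrict (cylinder n y) := by
  refine ext_of_generate_finite _ (generateFrom_cylindersFrom n) (isPiSystem_cylindersFrom n) ?_ ?_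
  · rintro _ ⟨m, hm, z, rfl⟩
    rw [Measure.map_apply (measurable_splice n y) (measurableSet_cylinder m z),
      Measure.restrict_apply (measurable_splice n y (measurableSet_cylinder m z)),
      Measure.restrict_apply (measurableSet_cylinder m z)]
    by_cases hz : z ∈ cylinder n y
    · rw [splice_preimage_inter hm h hz, Set.inter_eq_left.2 (fun t ht => by
        rw [← cylinder_eq_of_mem hz]; exact cylinder_anti hm z ht)]
      exact hμ m _ _ (splice_vert_of_le _ _ hm)
    · have e1 : cylinder m z ∩ cylinder n y = ∅ := by
        rw [Set.eq_empty_iff_forall_notMem]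
        rintro t ⟨h1, h2⟩
        exact hz fun k hk => (h1 k (hk.trans_le hm)).symm.trans (h2 k hk)
      have e2 : splice n y ⁻¹' cylinder m z ∩ cylinder n y' = ∅ := by
        rw [Set.eq_empty_iff_forall_notMem]
        rintro t ⟨h1, h2⟩
        have hv : y.vert n = t.vert n := h.trans (vert_eq_of_mem_cylinder h2 le_rfl).symm
        exact hz fun k hk => (h1 k (hk.trans_le hm)).symm.trans (splice_edge_of_lt hv hk)
      rw [e1, e2]
  · rw [Measure.map_apply (measurable_splice n y) MeasurableSet.univ, Set.preimage_univ,
      Measure.restrict_apply_univ, Measure.restrict_apply_univ]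
    exact hμ n _ _ h.symm

/-- A set of the `n`-th tail algebra is not affected by splicing below level `n`, so `map_splice`
applies to it. -/
theorem IsCentral.measure_inter_cylinder {μ : Measure Γ.Path} [IsFiniteMeasure μ]
    (hμ : IsCentral μ) {n : ℕ} {A : Set Γ.Path} (hA : TailMeasurable n A)
    {y y' : Γ.Path} (h : y.vert n = y'.vert n) :
    μ (A ∩ cylinder n y) = μ (A ∩ cylinder n y') := by
  rw [← Measure.restrict_apply hA.1, ← Measure.restrict_apply hA.1, ← hμ.map_splice h,
    Measure.map_apply (measurable_splice n y) hA.1]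
  congr 1
  ext z
  exact ⟨fun hz => hA.2 _ hz fun k hk => (splice_edge_of_le y z hk).symm,
    fun hz => hA.2 _ hz (splice_mem_tailClass n y z)⟩

theorem exists_mem_tailClass_edge_eq {n : ℕ} (x : Γ.Path) {e : Γ.E n}
    (he : Γ.tgt n e = x.vert (n + 1)) : ∃ z ∈ tailClass (n + 1) x, z.edge n = e := by
  obtain ⟨y, hy⟩ := exists_path_vert n (Γ.src n e)
  obtain ⟨y', -, hy'⟩ := exists_mem_cylinder_edge_eq y n e hy.symm
  have h : y'.vert (n + 1) = x.vert (n + 1) := by rw [← Path.tgt_edge, hy', he]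
  exact ⟨splice (n + 1) y' x, splice_mem_tailClass _ _ _,
    (splice_edge_of_lt h n.lt_succ_self).trans hy'⟩

/-- A class of `ξ_{n+1}` splits into classes of `ξ_n` according to the edge of level `n`; inductions
on the level of a class rest on this. -/
theorem mem_tailClass_succ_edge {n : ℕ} {x z : Γ.Path} (hz : z ∈ tailClass (n + 1) x)
    (y : Γ.Path) : y ∈ tailClass (n + 1) x ∧ y.edge n = z.edge n ↔ y ∈ tailClass n z := by
  constructor
  · rintro ⟨h1, h2⟩ k hk
    rcases hk.lt_or_eq with hk | rfl
    · rw [h1 k hk, hz k hk]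
    · exact h2
  · intro h
    exact ⟨fun k hk => (h k (by omega)).trans (hz k hk), h n le_rfl⟩

theorem finite_tailClass (n : ℕ) (x : Γ.Path) : (tailClass n x).Finite := by
  induction n generalizing x with
  | zero => exact (Set.finite_singleton x).subset fun y hy => Path.ext fun k => hy k k.zero_le
  | succ n ih =>
    have : ∀ e : Γ.E n, ({y ∈ tailClass (n + 1) x | y.edge n = e}).Finite := by
      intro e
      rcases Set.eq_empty_or_nonempty {y ∈ tailClass (n + 1) x | y.edge n = e} with h | ⟨z, hz, rfl⟩
      · rw [h]; exact Set.finite_empty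
      · exact (ih z).subset fun y hy => (mem_tailClass_succ_edge hz y).1 hy
    exact (Set.finite_iUnion this).subset fun y hy => Set.mem_iUnion.2 ⟨y.edge n, hy, rfl⟩

/-- The class of `x` in the partition `ξ_n` as a finite set. -/
noncomputable def tailFinset (n : ℕ) (x : Γ.Path) : Finset Γ.Path := (finite_tailClass n x).toFinset

theorem mem_tailFinset {n : ℕ} {x y : Γ.Path} : y ∈ tailFinset n x ↔ y ∈ tailClass n x :=
  Set.Finite.mem_toFinset _

/-- Every vertex of the level `n + 1` is the end of `r n` edges. -/
def InRegular (Γ : GradedGraph) (r : ℕ → ℕ) : Prop :=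
  ∀ n v, (Finset.univ.filter fun e => Γ.tgt n e = v).card = r n

theorem filter_tailFinset {n : ℕ} {x z : Γ.Path} (hz : z ∈ tailClass (n + 1) x) :
    (tailFinset (n + 1) x).filter (fun y => y.edge n = z.edge n) = tailFinset n z := by
  ext y
  rw [Finset.mem_filter, mem_tailFinset, mem_tailFinset, mem_tailClass_succ_edge hz]

theorem InRegular.card_tailFinset {r : ℕ → ℕ} (hr : Γ.InRegular r) (n : ℕ) (x : Γ.Path) :
    (tailFinset n x).card = ∏ i ∈ Finset.range n, r i := by
  induction n generalizing x with
  | zero =>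
    rw [Finset.prod_range_zero, Finset.card_eq_one]
    refine ⟨x, ?_⟩
    ext y
    rw [mem_tailFinset, Finset.mem_singleton]
    exact ⟨fun h => Path.ext fun k => h k k.zero_le, fun h => h ▸ self_mem_tailClass _ _⟩
  | succ n ih =>
    rw [Finset.card_eq_sum_card_fiberwise (f := fun y => y.edge n)
      (t := Finset.univ.filter fun e => Γ.tgt n e = x.vert (n + 1)), Finset.sum_const_nat
      (m := ∏ i ∈ Finset.range n, r i), hr, Finset.prod_range_succ, mul_comm]
    · intro e he
      obtain ⟨z, hz, rfl⟩ := exists_mem_tailClass_edge_eq x (Finset.mem_filter.1 he).2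
      rw [filter_tailFinset hz, ih]
    · intro y hy
      rw [Finset.mem_coe, Finset.mem_filter]
      exact ⟨Finset.mem_univ _, y.tgt_edge n ▸
        vert_eq_of_mem_tailClass (mem_tailFinset.1 hy) le_rfl⟩

end GradedGraph

/-! ### Conditional measures in graphs with constant in-degree on each level. -/

namespace GradedGraph

variable {Γ : GradedGraph}

/-- The number of paths to a vertex of level `n` in a graph whose vertices of level `i + 1` have
`r i` incoming edges. -/
def dim (r : ℕ → ℕ) (n : ℕ) : ℕ := ∏ i ∈ Finset.range n, r i

theorem dim_succ (r : ℕ → ℕ) (n : ℕ) : dim r (n + 1) = dim r n * r n :=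
  Finset.prod_range_succ _ _

theorem InRegular.card_tailFinset_eq_dim {r : ℕ → ℕ} (hr : Γ.InRegular r) (n : ℕ) (x : Γ.Path) :
    (tailFinset n x).card = dim r n := hr.card_tailFinset n x

theorem InRegular.dim_pos {r : ℕ → ℕ} (hr : Γ.InRegular r) (n : ℕ) : 0 < dim r n := by
  obtain ⟨x⟩ : Nonempty Γ.Path := inferInstance
  rw [← hr.card_tailFinset_eq_dim n x, Finset.card_pos]
  exact ⟨x, mem_tailFinset.2 (self_mem_tailClass n x)⟩

theorem InRegular.pos {r : ℕ → ℕ} (hr : Γ.InRegular r) (n : ℕ) : 0 < r n :=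
  Nat.pos_of_mul_pos_left (dim_succ r n ▸ hr.dim_pos (n + 1))

theorem InRegular.lintegral_condMeasure {r : ℕ → ℕ} (hr : Γ.InRegular r) (n : ℕ) (x : Γ.Path)
    (g : Γ.Path → ℝ≥0∞) :
    ∫⁻ y, g y ∂condMeasure n x = (dim r n : ℝ≥0∞)⁻¹ * ∑ y ∈ tailFinset n x, g y := by
  have h : tailClass n x = (tailFinset n x : Set Γ.Path) :=
    (Set.Finite.coe_toFinset (finite_tailClass n x)).symm
  rw [condMeasure, ProbabilityTheory.uniformOn, ProbabilityTheory.cond, lintegral_smul_measure,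
    h, Measure.count_apply_finset, hr.card_tailFinset_eq_dim, smul_eq_mul, lintegral_finset]
  simp

theorem isProbabilityMeasure_condMeasure (n : ℕ) (x : Γ.Path) :
    IsProbabilityMeasure (condMeasure n x) :=
  ProbabilityTheory.isProbabilityMeasure_uniformOn (finite_tailClass n x) ⟨x, self_mem_tailClass n x⟩

theorem tailFinset_eq_image_splice {n : ℕ} {x z : Γ.Path} (h : x.vert n = z.vert n) :
    tailFinset n z = (tailFinset n x).image fun y => splice n y z := by
  ext y
  rw [mem_tailFinset, Finset.mem_image]
  constructor
  · intro hy
    have hv : y.vert n = x.vert n := (vert_eq_of_mem_tailClass hy le_rfl).trans h.symm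
    refine ⟨splice n y x, mem_tailFinset.2 (splice_mem_tailClass n y x), Path.ext fun k => ?_⟩
    rcases lt_or_ge k n with hk | hk
    · rw [splice_edge_of_lt ((splice_vert_of_le _ _ le_rfl).trans h) hk, splice_edge_of_lt hv hk]
    · rw [splice_edge_of_le _ _ hk, hy k hk]
  · rintro ⟨y, -, rfl⟩
    exact splice_mem_tailClass n y z

theorem injOn_splice {n : ℕ} {x z : Γ.Path} (h : x.vert n = z.vert n) :
    Set.InjOn (fun y => splice n y z) (tailFinset n x : Set Γ.Path) := by
  intro y hy y' hy' e
  rw [Finset.mem_coe, mem_tailFinset] at hy hy'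
  refine Path.ext fun k => ?_
  rcases lt_or_ge k n with hk | hk
  · rw [← splice_edge_of_lt ((vert_eq_of_mem_tailClass hy le_rfl).trans h) hk,
      ← splice_edge_of_lt ((vert_eq_of_mem_tailClass hy' le_rfl).trans h) hk]
    exact congrArg (fun w => Path.edge w k) e
  · rw [hy k hk, hy' k hk]

/-- With one representative `x` fixed for each vertex, the conditional integral becomes a finite sum
in which `z` enters only through `splice`. This yields its measurability in `z` and its mean. -/
theorem InRegular.lintegral_condMeasure_eq_splice {r : ℕ → ℕ} (hr : Γ.InRegular r) {n : ℕ}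
    {x z : Γ.Path} (h : x.vert n = z.vert n) (g : Γ.Path → ℝ≥0∞) :
    ∫⁻ y, g y ∂condMeasure n z
      = (dim r n : ℝ≥0∞)⁻¹ * ∑ y ∈ tailFinset n x, g (splice n y z) := by
  rw [hr.lintegral_condMeasure, tailFinset_eq_image_splice h, Finset.sum_image (injOn_splice h)]

theorem setOf_vert_eq_biUnion (n : ℕ) (x : Γ.Path) :
    {z : Γ.Path | z.vert n = x.vert n} = ⋃ y ∈ tailFinset n x, cylinder n y := by
  ext z
  simp only [Set.mem_ofPred_eq, Set.mem_iUnion, mem_tailFinset, exists_prop]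
  constructor
  · intro h
    exact ⟨splice n z x, splice_mem_tailClass n z x, fun k hk => (splice_edge_of_lt h hk).symm⟩
  · rintro ⟨y, hy, hz⟩
    rw [vert_eq_of_mem_cylinder hz le_rfl, vert_eq_of_mem_tailClass hy le_rfl]

theorem setOf_edge_eq_biUnion (n : ℕ) (x : Γ.Path) :
    {z : Γ.Path | z.edge n = x.edge n} = ⋃ y ∈ tailFinset n x, cylinder (n + 1) y := by
  ext z
  simp only [Set.mem_ofPred_eq, Set.mem_iUnion, mem_tailFinset, exists_prop]
  constructor
  · intro h
    refine ⟨splice n z x, splice_mem_tailClass n z x, fun k hk => ?_⟩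
    rcases Nat.lt_succ_iff_lt_or_eq.1 hk with hk | rfl
    · exact (splice_edge_of_lt (Path.vert_eq_of_edge_eq h) hk).symm
    · rw [splice_edge_of_le _ _ le_rfl, h]
  · rintro ⟨y, hy, hz⟩
    rw [hz n n.lt_succ_self, hy n le_rfl]

theorem pairwiseDisjoint_cylinder {n m : ℕ} (h : n ≤ m) (x : Γ.Path) :
    Set.PairwiseDisjoint (tailFinset n x : Set Γ.Path) (cylinder m) := by
  intro y hy y' hy' hne
  rw [Finset.mem_coe, mem_tailFinset] at hy hy'
  refine Set.disjoint_left.2 fun z hz hz' => hne (Path.ext fun k => ?_)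
  rcases lt_or_ge k n with hk | hk
  · rw [← hz k (hk.trans_le h), hz' k (hk.trans_le h)]
  · rw [hy k hk, hy' k hk]

theorem measurableSet_vert_eq (n : ℕ) (v : Γ.V n) : MeasurableSet {x : Γ.Path | x.vert n = v} :=
  measurableSet_vert n {v}

theorem lintegral_eq_sum_vert (μ : Measure Γ.Path) (n : ℕ) (g : Γ.Path → ℝ≥0∞) :
    ∫⁻ x, g x ∂μ = ∑ v : Γ.V n, ∫⁻ x in {x | x.vert n = v}, g x ∂μ := by
  rw [← setLIntegral_univ, ← lintegral_biUnion_finset]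
  · congr 2
    ext x; simp
  · intro v _ w _ hne
    exact Set.disjoint_left.2 fun z hz hz' => hne (hz.symm.trans hz')
  · exact fun v _ => measurableSet_vert_eq n v

section Central

variable {μ : Measure Γ.Path} [IsFiniteMeasure μ] {r : ℕ → ℕ} {n : ℕ} {A : Set Γ.Path}

theorem IsCentral.measure_inter_vert (hμ : IsCentral μ) (hr : Γ.InRegular r)
    (hA : TailMeasurable n A) (x : Γ.Path) :
    μ (A ∩ {z | z.vert n = x.vert n}) = dim r n * μ (A ∩ cylinder n x) := by
  rw [setOf_vert_eq_biUnion, Set.inter_iUnion₂, measure_biUnion_finset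
    ((pairwiseDisjoint_cylinder le_rfl x).mono fun _ => Set.inter_subset_right)
    fun y _ => hA.1.inter (measurableSet_cylinder n y), Finset.sum_congr rfl fun y hy =>
    hμ.measure_inter_cylinder hA (vert_eq_of_mem_tailClass (mem_tailFinset.1 hy) le_rfl),
    Finset.sum_const, hr.card_tailFinset_eq_dim, nsmul_eq_mul]

/-- All initial segments to the end vertex carry the same share of `A`; a fraction `1 / r n` of them
uses the given edge. -/
theorem IsCentral.measure_inter_edge (hμ : IsCentral μ) (hr : Γ.InRegular r)
    (hA : TailMeasurable (n + 1) A) (e : Γ.E n) :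
    r n * μ (A ∩ {z | z.edge n = e}) = μ (A ∩ {z | z.vert (n + 1) = Γ.tgt n e}) := by
  obtain ⟨x, hx⟩ := exists_path_vert n (Γ.src n e)
  obtain ⟨z, -, rfl⟩ := exists_mem_cylinder_edge_eq x n e hx.symm
  rw [Path.tgt_edge, hμ.measure_inter_vert hr hA, setOf_edge_eq_biUnion, Set.inter_iUnion₂,
    measure_biUnion_finset ((pairwiseDisjoint_cylinder n.le_succ z).mono
    fun _ => Set.inter_subset_right) fun y _ => hA.1.inter (measurableSet_cylinder (n + 1) y),
    Finset.sum_congr rfl fun y hy => hμ.measure_inter_cylinder hA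
      (vert_eq_of_mem_tailClass (mem_tailFinset.1 hy) n.le_succ),
    Finset.sum_const, hr.card_tailFinset_eq_dim, nsmul_eq_mul, dim_succ]
  push_cast
  ring

/-- The tower property: `condMeasure` disintegrates `μ`. Over a fixed vertex, splicing in `y`
carries each of the `dim r n` cylinders onto the cylinder of `y`, which cancels the normalization.
-/
theorem IsCentral.lintegral_lintegral_condMeasure (hμ : IsCentral μ) (hr : Γ.InRegular r) (n : ℕ)
    {g : Γ.Path → ℝ≥0∞} (hg : Measurable g) :
    ∫⁻ x, ∫⁻ y, g y ∂condMeasure n x ∂μ = ∫⁻ x, g x ∂μ := by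
  rw [lintegral_eq_sum_vert μ n, lintegral_eq_sum_vert μ n]
  refine Finset.sum_congr rfl fun v _ => ?_
  obtain ⟨x, rfl⟩ := exists_path_vert n v
  have hd : (dim r n : ℝ≥0∞) ≠ 0 := by exact_mod_cast (hr.dim_pos n).ne'
  have hsplit : ∀ f : Γ.Path → ℝ≥0∞, ∫⁻ z in {z | z.vert n = x.vert n}, f z ∂μ
      = ∑ y ∈ tailFinset n x, ∫⁻ z in cylinder n y, f z ∂μ := fun f => by
    rw [setOf_vert_eq_biUnion, lintegral_biUnion_finset (pairwiseDisjoint_cylinder le_rfl x)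
      fun y _ => measurableSet_cylinder n y]
  have hm : ∀ y, Measurable fun z => g (splice n y z) := fun y => hg.comp (measurable_splice n y)
  rw [setLIntegral_congr_fun (measurableSet_vert_eq n _)
    (fun z hz => hr.lintegral_condMeasure_eq_splice (Eq.symm hz) g),
    lintegral_const_mul _ (Finset.measurable_sum _ fun y _ => hm y),
    lintegral_finsetSum _ fun y _ => hm y]
  have key : ∀ y ∈ tailFinset n x, ∫⁻ z in {z | z.vert n = x.vert n}, g (splice n y z) ∂μ
      = dim r n * ∫⁻ z in cylinder n y, g z ∂μ := by
    intro y hy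
    rw [hsplit, Finset.sum_congr rfl (g := fun _ => ∫⁻ z in cylinder n y, g z ∂μ), Finset.sum_const,
      hr.card_tailFinset_eq_dim, nsmul_eq_mul]
    intro y' hy'
    rw [← hμ.map_splice ((vert_eq_of_mem_tailClass (mem_tailFinset.1 hy) le_rfl).trans
      (vert_eq_of_mem_tailClass (mem_tailFinset.1 hy') le_rfl).symm),
      lintegral_map hg (measurable_splice n y)]
  rw [Finset.sum_congr rfl key, ← Finset.mul_sum, ← mul_assoc, ENNReal.inv_mul_cancel hd
    (ENNReal.natCast_ne_top _), one_mul, hsplit]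

end Central

theorem InRegular.measurable_lintegral_condMeasure {r : ℕ → ℕ} (hr : Γ.InRegular r) (n : ℕ)
    {g : Γ.Path → ℝ≥0∞} (hg : Measurable g) :
    Measurable fun x => ∫⁻ y, g y ∂condMeasure n x := by
  choose x hx using exists_path_vert (Γ := Γ) n
  have : (fun z => ∫⁻ y, g y ∂condMeasure n z) = fun z => ∑ v : Γ.V n,
      Set.indicator {z | z.vert n = v}
        (fun z => (dim r n : ℝ≥0∞)⁻¹ * ∑ y ∈ tailFinset n (x v), g (splice n y z)) z := by
    ext z
    simp only [Set.indicator_apply, Set.mem_ofPred_eq]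
    rw [Finset.sum_eq_single (z.vert n), if_pos rfl, hr.lintegral_condMeasure_eq_splice (hx _)]
    · intro v _ hv
      rw [if_neg (Ne.symm hv)]
    · simp
  rw [this]
  exact Finset.measurable_sum _ fun v _ => Measurable.indicator (measurable_const.mul
    (Finset.measurable_sum _ fun y _ => hg.comp (measurable_splice n y)))
    (measurableSet_vert_eq n v)

/-- The distribution of the vertex of level `n` under the conditional measure on a class of
`ξ_{n+1}`. -/
theorem InRegular.lintegral_condMeasure_vert {r : ℕ → ℕ} (hr : Γ.InRegular r) (n : ℕ)
    (x : Γ.Path) (h : Γ.V n → ℝ≥0∞) :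
    r n * ∫⁻ y, h (y.vert n) ∂condMeasure (n + 1) x
      = ∑ e with Γ.tgt n e = x.vert (n + 1), h (Γ.src n e) := by
  have hd : (dim r n : ℝ≥0∞) ≠ 0 := by exact_mod_cast (hr.dim_pos n).ne'
  have hrn : (r n : ℝ≥0∞) ≠ 0 := by exact_mod_cast (hr.pos n).ne'
  rw [hr.lintegral_condMeasure, ← Finset.sum_fiberwise_of_maps_to (g := fun y => y.edge n)
    (t := Finset.univ.filter fun e => Γ.tgt n e = x.vert (n + 1)), dim_succ]
  · rw [Finset.sum_congr rfl (g := fun e => dim r n * h (Γ.src n e)), ← Finset.mul_sum,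
      ← mul_assoc, ← mul_assoc]
    · push_cast
      rw [ENNReal.mul_inv (.inl hd) (.inl (ENNReal.natCast_ne_top _)), mul_comm (_⁻¹),
        ← mul_assoc, ENNReal.mul_inv_cancel hrn (ENNReal.natCast_ne_top _), one_mul,
        ENNReal.inv_mul_cancel hd (ENNReal.natCast_ne_top _), one_mul]
    · intro e he
      obtain ⟨z, hz, rfl⟩ := exists_mem_tailClass_edge_eq x (Finset.mem_filter.1 he).2
      rw [filter_tailFinset hz, Finset.sum_congr rfl (g := fun _ => h (Γ.src n (z.edge n))),
        Finset.sum_const, hr.card_tailFinset_eq_dim, nsmul_eq_mul]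
      intro y hy
      exact congrArg h (vert_eq_of_mem_tailClass (mem_tailFinset.1 hy) le_rfl)
  · intro y hy
    rw [Finset.mem_filter]
    exact ⟨Finset.mem_univ _, y.tgt_edge n ▸
      vert_eq_of_mem_tailClass (mem_tailFinset.1 hy) le_rfl⟩

end GradedGraph

/-! ### Labelled binary trees and product weights. -/

/-- Complete binary trees of height `n` with leaves labelled by elements of `A`. -/
def LabeledTree (A : Type) : ℕ → Type
  | 0 => A
  | n + 1 => LabeledTree A n × LabeledTree A n

namespace LabeledTree

variable {A R S : Type}

instance instFintype [Fintype A] : ∀ n, Fintype (LabeledTree A n)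
  | 0 => inferInstanceAs (Fintype A)
  | n + 1 =>
    have := instFintype n
    inferInstanceAs (Fintype (LabeledTree A n × LabeledTree A n))

/-- The left subtree. -/
def left {n : ℕ} (t : LabeledTree A (n + 1)) : LabeledTree A n := t.1

/-- The right subtree. -/
def right {n : ℕ} (t : LabeledTree A (n + 1)) : LabeledTree A n := t.2

/-- The tree with given subtrees. -/
def node {n : ℕ} (a b : LabeledTree A n) : LabeledTree A (n + 1) := (a, b)

/-- The label of the leftmost leaf. -/
def leaf : ∀ {n}, LabeledTree A n → A
  | 0, a => a
  | _ + 1, t => leaf t.left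

/-- The product weight of a tree for given weights of the labels. -/
def weight [Mul R] (w : A → R) : ∀ {n}, LabeledTree A n → R
  | 0, a => w a
  | _ + 1, t => weight w t.left * weight w t.right

theorem sum_succ [Fintype A] [AddCommMonoid R] {n : ℕ} (f : LabeledTree A (n + 1) → R) :
    ∑ t, f t = ∑ a : LabeledTree A n, ∑ b : LabeledTree A n, f (node a b) :=
  Fintype.sum_prod_type (α₁ := LabeledTree A n) (α₂ := LabeledTree A n) f

/-- Needed to pass between weights in `ℝ≥0`, `ℝ` and `ℝ≥0∞`: measures are built in the last,
variances and distances estimated in `ℝ`. -/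
theorem map_weight [CommSemiring R] [CommSemiring S] (φ : R →+* S) (w : A → R) {n : ℕ}
    (t : LabeledTree A n) : φ (weight w t) = weight (fun a => φ (w a)) t := by
  induction n with
  | zero => rfl
  | succ n ih => exact (map_mul φ _ _).trans (congrArg₂ _ (ih t.left) (ih t.right))

theorem weight_nonneg {w : A → ℝ} (hw : ∀ a, 0 ≤ w a) {n : ℕ} (t : LabeledTree A n) :
    0 ≤ weight w t := by
  induction n with
  | zero => exact hw t
  | succ n ih => exact mul_nonneg (ih t.left) (ih t.right)

theorem sum_weight [Fintype A] [CommSemiring R] {w : A → R} (hw : ∑ a, w a = 1) (n : ℕ) :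
    ∑ t : LabeledTree A n, weight w t = 1 := by
  induction n with
  | zero => exact hw
  | succ n ih =>
    rw [sum_succ]
    change ∑ a : LabeledTree A n, ∑ b : LabeledTree A n, weight w a * weight w b = 1
    rw [← Finset.sum_mul_sum, ih, one_mul]

theorem sum_weight_mul_fst [Fintype A] [CommSemiring R] {w : A → R} (hw : ∑ a, w a = 1) {n : ℕ}
    (f : LabeledTree A n → R) :
    ∑ t : LabeledTree A (n + 1), weight w t * f t.left = ∑ t, weight w t * f t := by
  rw [sum_succ]
  refine Finset.sum_congr rfl fun a _ => ?_
  change ∑ b : LabeledTree A n, weight w a * weight w b * f a = _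
  rw [← Finset.sum_mul, ← Finset.mul_sum, sum_weight hw, mul_one]

theorem sum_weight_mul_snd [Fintype A] [CommSemiring R] {w : A → R} (hw : ∑ a, w a = 1) {n : ℕ}
    (f : LabeledTree A n → R) :
    ∑ t : LabeledTree A (n + 1), weight w t * f t.right = ∑ t, weight w t * f t := by
  rw [sum_succ, Finset.sum_comm]
  refine Finset.sum_congr rfl fun b _ => ?_
  change ∑ a : LabeledTree A n, weight w a * weight w b * f b = _
  rw [← Finset.sum_mul, ← Finset.sum_mul, sum_weight hw, one_mul]

theorem sum_weight_mul_leaf [Fintype A] [CommSemiring R] {w : A → R} (hw : ∑ a, w a = 1) (n : ℕ)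
    (f : A → R) : ∑ t : LabeledTree A n, weight w t * f (leaf t) = ∑ a, w a * f a := by
  induction n with
  | zero => rfl
  | succ n ih => rw [← ih]; exact sum_weight_mul_fst hw fun t => f (leaf t)

end LabeledTree

open LabeledTree

/-! ### Graphs with joins, and the central measures of random trees. -/

namespace GradedGraph

variable {Γ : GradedGraph}

/-- Vertices of level `n + 1` have `r n` incoming edges, and from the level `k₀` on, half of the
edges to `join n u v` come from `u`, the other half from `v`. -/
structure IsJoin (Γ : GradedGraph) (r : ℕ → ℕ) (k₀ : ℕ)
    (join : ∀ n, Γ.V n → Γ.V n → Γ.V (n + 1)) : Prop where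
  inRegular : Γ.InRegular r
  sum_src_nat : ∀ n, k₀ ≤ n → ∀ (u v) (h : Γ.V n → ℕ),
    2 * ∑ e with Γ.tgt n e = join n u v, h (Γ.src n e) = r n * (h u + h v)

section

variable {r : ℕ → ℕ} {k₀ : ℕ} {join : ∀ n, Γ.V n → Γ.V n → Γ.V (n + 1)}

/-- Indicators of vertices reduce the identity to edge counts, and these can be cast into any
semiring. -/
theorem IsJoin.sum_src (hj : Γ.IsJoin r k₀ join) {R : Type} [CommSemiring R] {n : ℕ} (hn : k₀ ≤ n)
    (u v : Γ.V n) (h : Γ.V n → R) :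
    2 * ∑ e with Γ.tgt n e = join n u v, h (Γ.src n e) = r n * (h u + h v) := by
  have key : ∀ w, (2 : R) * ∑ e with Γ.tgt n e = join n u v, (if Γ.src n e = w then 1 else 0)
      = r n * ((if u = w then 1 else 0) + (if v = w then 1 else 0)) := fun w => by
    have := congrArg (Nat.cast (R := R)) (hj.sum_src_nat n hn u v fun x => if x = w then 1 else 0)
    push_cast at this
    exact this
  have hsum : ∀ x, h x = ∑ w, (if x = w then 1 else 0) * h w := fun x => by simp
  rw [Finset.sum_congr rfl fun e _ => hsum (Γ.src n e), Finset.sum_comm, Finset.mul_sum,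
    Finset.sum_congr rfl fun w _ => by rw [← Finset.sum_mul, ← mul_assoc, key w]]
  simp_rw [mul_assoc, add_mul, ← Finset.mul_sum, Finset.sum_add_distrib]
  rw [← hsum, ← hsum]

variable {A : Type}

/-- The vertices encoded by labelled trees: on the levels up to `k₀` the vertex given by the leftmost
label, and then the join of the vertices encoded by the two subtrees. -/
def enc (join : ∀ n, Γ.V n → Γ.V n → Γ.V (n + 1)) (base : ∀ n, A → Γ.V n) (k₀ : ℕ) :
    ∀ n, LabeledTree A n → Γ.V n
  | 0, t => base 0 (leaf t)
  | n + 1, t => if n + 1 ≤ k₀ then base (n + 1) (leaf t) else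
      join n (enc join base k₀ n t.left) (enc join base k₀ n t.right)

variable {base : ∀ n, A → Γ.V n}

theorem enc_of_le {n : ℕ} (h : n ≤ k₀) (t : LabeledTree A n) :
    enc join base k₀ n t = base n (leaf t) := by
  cases n with
  | zero => rfl
  | succ n => exact if_pos h

theorem enc_succ {n : ℕ} (h : k₀ ≤ n) (t : LabeledTree A (n + 1)) :
    enc join base k₀ (n + 1) t = join n (enc join base k₀ n t.left) (enc join base k₀ n t.right) :=
  if_neg (by omega)

variable [Fintype A] {w : A → ℝ≥0∞}

/-- The distribution of the vertex encoded by a random tree with independent labels. -/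
noncomputable def encLaw (join : ∀ n, Γ.V n → Γ.V n → Γ.V (n + 1)) (base : ∀ n, A → Γ.V n) (k₀ : ℕ)
    (w : A → ℝ≥0∞) (n : ℕ) (v : Γ.V n) : ℝ≥0∞ :=
  ∑ t : LabeledTree A n with enc join base k₀ n t = v, weight w t

theorem sum_encLaw_mul (n : ℕ) (f : Γ.V n → ℝ≥0∞) :
    ∑ v, encLaw join base k₀ w n v * f v
      = ∑ t : LabeledTree A n, weight w t * f (enc join base k₀ n t) := by
  rw [← Finset.sum_fiberwise (s := Finset.univ) (g := enc join base k₀ n)]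
  refine Finset.sum_congr rfl fun v _ => ?_
  rw [encLaw, Finset.sum_mul]
  exact Finset.sum_congr rfl fun t ht => by rw [(Finset.mem_filter.1 ht).2]

theorem sum_encLaw (hw : ∑ a, w a = 1) (n : ℕ) : ∑ v, encLaw join base k₀ w n v = 1 := by
  simpa [sum_weight hw] using sum_encLaw_mul (join := join) (base := base) (k₀ := k₀) (w := w) n
    fun _ => 1

/-- On level `k₀` only the leftmost label is seen. This is what makes the distribution on that level
arbitrary. -/
theorem encLaw_self (hw : ∑ a, w a = 1) (v : Γ.V k₀) :
    encLaw join base k₀ w k₀ v = ∑ a with base k₀ a = v, w a := by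
  rw [encLaw, Finset.sum_filter, Finset.sum_filter]
  simp_rw [enc_of_le le_rfl]
  simpa using sum_weight_mul_leaf hw k₀ fun a => if base k₀ a = v then 1 else 0

/-- Group the edges by their targets: a random tree sends half of the `r n` incoming edges to each
of its subtrees, and each subtree has the law `encLaw` of level `n`. Division by `dim r n` turns
this into harmonicity. -/
theorem IsJoin.encLaw_eq (hj : Γ.IsJoin r k₀ join) (hw : ∑ a, w a = 1) {n : ℕ} (hn : k₀ ≤ n)
    (v : Γ.V n) : ∑ e with Γ.src n e = v, encLaw join base k₀ w (n + 1) (Γ.tgt n e)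
      = r n * encLaw join base k₀ w n v := by
  have h1 : ∑ e with Γ.src n e = v, encLaw join base k₀ w (n + 1) (Γ.tgt n e)
      = ∑ u, encLaw join base k₀ w (n + 1) u *
        ∑ e with Γ.tgt n e = u, if Γ.src n e = v then 1 else 0 := by
    rw [Finset.sum_filter, ← Finset.sum_fiberwise (s := Finset.univ) (g := Γ.tgt n)]
    refine Finset.sum_congr rfl fun u _ => ?_
    rw [Finset.mul_sum]
    refine Finset.sum_congr rfl fun e he => ?_
    rw [(Finset.mem_filter.1 he).2]
    simp
  have h2 : (2 : ℝ≥0∞) * ∑ e with Γ.src n e = v, encLaw join base k₀ w (n + 1) (Γ.tgt n e)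
      = 2 * (r n * encLaw join base k₀ w n v) := by
    have h3 : encLaw join base k₀ w n v
        = ∑ t : LabeledTree A n, weight w t * if enc join base k₀ n t = v then 1 else 0 := by
      rw [encLaw, Finset.sum_filter]
      exact Finset.sum_congr rfl fun t _ => by simp
    have hf := sum_weight_mul_fst hw
      fun t : LabeledTree A n => if enc join base k₀ n t = v then (1 : ℝ≥0∞) else 0
    have hs := sum_weight_mul_snd hw
      fun t : LabeledTree A n => if enc join base k₀ n t = v then (1 : ℝ≥0∞) else 0
    rw [h1, sum_encLaw_mul, Finset.mul_sum, two_mul, ← mul_add, h3]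
    nth_rw 1 [← hf]
    rw [← hs, ← Finset.sum_add_distrib, Finset.mul_sum]
    refine Finset.sum_congr rfl fun t _ => ?_
    rw [mul_left_comm, enc_succ hn, hj.sum_src hn (enc join base k₀ n t.left)
      (enc join base k₀ n t.right) fun u => if u = v then (1 : ℝ≥0∞) else 0]
    ring
  exact (ENNReal.mul_right_inj two_ne_zero ENNReal.ofNat_ne_top).1 h2

/-- The harmonic function whose values from the level `k₀` on are given by `encLaw`. -/
noncomputable def encHarmonic (join : ∀ n, Γ.V n → Γ.V n → Γ.V (n + 1)) (base : ∀ n, A → Γ.V n)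
    (k₀ : ℕ) (w : A → ℝ≥0∞) (r : ℕ → ℕ) (n : ℕ) (v : Γ.V n) : ℝ≥0∞ :=
  if k₀ ≤ n then (dim r n : ℝ≥0∞)⁻¹ * encLaw join base k₀ w n v
  else ∑ e with Γ.src n e = v, encHarmonic join base k₀ w r (n + 1) (Γ.tgt n e)
termination_by k₀ - n

theorem encHarmonic_of_le {n : ℕ} (h : k₀ ≤ n) (v : Γ.V n) :
    encHarmonic join base k₀ w r n v = (dim r n : ℝ≥0∞)⁻¹ * encLaw join base k₀ w n v := by
  rw [encHarmonic, if_pos h]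

theorem IsJoin.encHarmonic_eq (hj : Γ.IsJoin r k₀ join) (hw : ∑ a, w a = 1) (n : ℕ) (v : Γ.V n) :
    ∑ e with Γ.src n e = v, encHarmonic join base k₀ w r (n + 1) (Γ.tgt n e)
      = encHarmonic join base k₀ w r n v := by
  rcases le_or_gt k₀ n with h | h
  · simp_rw [encHarmonic_of_le h, encHarmonic_of_le (Nat.le_succ_of_le h)]
    have hrn : (r n : ℝ≥0∞) ≠ 0 := by exact_mod_cast (hj.inRegular.pos n).ne'
    rw [← Finset.mul_sum, hj.encLaw_eq hw h, dim_succ, Nat.cast_mul, ENNReal.mul_inv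
      (.inr (ENNReal.natCast_ne_top _)) (.inl (ENNReal.natCast_ne_top _)), mul_assoc, ← mul_assoc _ _
      (encLaw _ _ _ _ _ _), ENNReal.inv_mul_cancel hrn (ENNReal.natCast_ne_top _), one_mul]
  · conv_rhs => rw [encHarmonic, if_neg h.not_ge]

/-- The normalization is explicit from `k₀` on and descends by harmonicity and in-regularity; level
0 gives the value 1 at the root. -/
theorem IsJoin.sum_encHarmonic (hj : Γ.IsJoin r k₀ join) (hw : ∑ a, w a = 1) (n : ℕ) :
    dim r n * ∑ v, encHarmonic join base k₀ w r n v = 1 := by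
  by_cases h : k₀ ≤ n
  · simp_rw [encHarmonic_of_le h]
    have hd : (dim r n : ℝ≥0∞) ≠ 0 := by exact_mod_cast (hj.inRegular.dim_pos n).ne'
    rw [← Finset.mul_sum, sum_encLaw hw, mul_one,
      ENNReal.mul_inv_cancel hd (ENNReal.natCast_ne_top _)]
  · rw [← hj.sum_encHarmonic hw (n + 1)]
    simp_rw [← hj.encHarmonic_eq hw n]
    rw [Finset.sum_fiberwise, ← Finset.sum_fiberwise (s := Finset.univ) (g := Γ.tgt n), dim_succ,
      Nat.cast_mul, mul_assoc, Finset.mul_sum (a := (r n : ℝ≥0∞))]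
    congr 1
    refine Finset.sum_congr rfl fun v _ => ?_
    rw [Finset.sum_congr rfl (g := fun _ => encHarmonic join base k₀ w r (n + 1) v), Finset.sum_const,
      hj.inRegular, nsmul_eq_mul]
    intro e he
    rw [(Finset.mem_filter.1 he).2]
termination_by k₀ - n

theorem IsJoin.exists_measure (hj : Γ.IsJoin r k₀ join) (base : ∀ n, A → Γ.V n)
    (hw : ∑ a, w a = 1) :
    ∃ μ : Measure Γ.Path, IsProbabilityMeasure μ ∧ IsCentral μ ∧
      ∀ n, k₀ ≤ n → ∀ v, μ {x | x.vert n = v} = encLaw join base k₀ w n v := by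
  have h0 : encHarmonic join base k₀ w r 0 Γ.root = 1 := by
    rw [← hj.sum_encHarmonic (base := base) hw 0, Finset.sum_eq_single Γ.root
      (fun v _ hv => absurd (Γ.eq_root v) hv) (by simp)]
    simp [dim]
  obtain ⟨μ, hμ, hc⟩ := exists_measure_cylinder_eq (encHarmonic join base k₀ w r) h0
    (hj.encHarmonic_eq hw)
  have hcent : IsCentral μ := fun n x y h => by rw [hc, hc, h]
  refine ⟨μ, hμ, hcent, fun n hn v => ?_⟩
  obtain ⟨x, rfl⟩ := exists_path_vert n v
  have hd : (dim r n : ℝ≥0∞) ≠ 0 := by exact_mod_cast (hj.inRegular.dim_pos n).ne'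
  have := hcent.measure_inter_vert hj.inRegular (n := n) (A := Set.univ)
    ⟨MeasurableSet.univ, fun _ _ => Set.subset_univ _⟩ x
  rw [Set.univ_inter, Set.univ_inter, hc, encHarmonic_of_le hn, ← mul_assoc,
    ENNReal.mul_inv_cancel hd (ENNReal.natCast_ne_top _), one_mul] at this
  exact this

end

end GradedGraph

/-! ### Ergodicity by halving of variances. -/

namespace GradedGraph

variable {Γ : GradedGraph} {r : ℕ → ℕ} {k₀ : ℕ} {join : ∀ n, Γ.V n → Γ.V n → Γ.V (n + 1)}
  {A : Type} {base : ∀ n, A → Γ.V n} {μ : Measure Γ.Path}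

/-- The mean over the edges to a vertex of a function on the vertices of the preceding level. -/
noncomputable def predMean (r : ℕ → ℕ) (n : ℕ) (h : Γ.V n → ℝ) (v : Γ.V (n + 1)) : ℝ :=
  (∑ e with Γ.tgt n e = v, h (Γ.src n e)) / r n

theorem IsJoin.predMean_enc (hj : Γ.IsJoin r k₀ join) {n : ℕ} (hn : k₀ ≤ n) (h : Γ.V n → ℝ)
    (t : LabeledTree A (n + 1)) :
    predMean r n h (enc join base k₀ (n + 1) t)
      = (h (enc join base k₀ n t.left) + h (enc join base k₀ n t.right)) / 2 := by
  have hrn : (r n : ℝ) ≠ 0 := by exact_mod_cast (hj.inRegular.pos n).ne'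
  have := hj.sum_src hn (enc join base k₀ n t.left) (enc join base k₀ n t.right) h
  rw [predMean, enc_succ hn]
  field_simp
  linarith

variable [Fintype A]

theorem IsJoin.sum_weight_mul_predMean (hj : Γ.IsJoin r k₀ join) {w : A → ℝ} (hw : ∑ a, w a = 1)
    {n : ℕ} (hn : k₀ ≤ n) (h : Γ.V n → ℝ) :
    ∑ t : LabeledTree A (n + 1), weight w t * predMean r n h (enc join base k₀ (n + 1) t)
      = ∑ t : LabeledTree A n, weight w t * h (enc join base k₀ n t) := by
  have hf := sum_weight_mul_fst hw fun t : LabeledTree A n => h (enc join base k₀ n t)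
  have hs := sum_weight_mul_snd hw fun t : LabeledTree A n => h (enc join base k₀ n t)
  simp_rw [hj.predMean_enc hn, mul_div_assoc', mul_add, ← Finset.sum_div, Finset.sum_add_distrib]
  rw [hf, hs]
  ring

/-- The two subtrees are independent and `h` is centred, so the cross term vanishes and the mean of
two copies has half the variance. -/
theorem IsJoin.sum_weight_mul_predMean_sq (hj : Γ.IsJoin r k₀ join) {w : A → ℝ}
    (hw : ∑ a, w a = 1) {n : ℕ} (hn : k₀ ≤ n) (h : Γ.V n → ℝ)
    (hh : ∑ t : LabeledTree A n, weight w t * h (enc join base k₀ n t) = 0) :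
    ∑ t : LabeledTree A (n + 1), weight w t * predMean r n h (enc join base k₀ (n + 1) t) ^ 2
      = (∑ t : LabeledTree A n, weight w t * h (enc join base k₀ n t) ^ 2) / 2 := by
  have hf := sum_weight_mul_fst hw fun t : LabeledTree A n => h (enc join base k₀ n t) ^ 2
  have hs := sum_weight_mul_snd hw fun t : LabeledTree A n => h (enc join base k₀ n t) ^ 2
  have hm : ∑ t : LabeledTree A (n + 1), weight w t *
      (h (enc join base k₀ n t.left) * h (enc join base k₀ n t.right)) = 0 := by
    rw [sum_succ]
    calc _ = ∑ a : LabeledTree A n, ∑ b : LabeledTree A n,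
          (weight w a * h (enc join base k₀ n a)) * (weight w b * h (enc join base k₀ n b)) :=
        Finset.sum_congr rfl fun a _ => Finset.sum_congr rfl fun b _ => mul_mul_mul_comm _ _ _ _
      _ = 0 := by rw [← Finset.sum_mul_sum, hh, zero_mul]
  calc _ = ∑ t : LabeledTree A (n + 1),
        ((weight w t * h (enc join base k₀ n t.left) ^ 2
          + weight w t * h (enc join base k₀ n t.right) ^ 2) / 4
          + weight w t * (h (enc join base k₀ n t.left) * h (enc join base k₀ n t.right)) / 2) :=
        Finset.sum_congr rfl fun t _ => by rw [hj.predMean_enc hn]; ring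
    _ = _ := by
      rw [Finset.sum_add_distrib, ← Finset.sum_div, ← Finset.sum_div, Finset.sum_add_distrib, hm,
        hf, hs]
      ring

/-- The mean of a function of the vertex of level `n` over a set of paths. -/
noncomputable def vertSum (μ : Measure Γ.Path) (A : Set Γ.Path) (n : ℕ) (h : Γ.V n → ℝ) : ℝ :=
  ∑ v, μ.real (A ∩ {x | x.vert n = v}) * h v

theorem vertSum_univ (n : ℕ) {w : A → ℝ}
    (hlaw : ∀ v, μ.real {x | x.vert n = v}
      = ∑ t : LabeledTree A n with enc join base k₀ n t = v, weight w t) (h : Γ.V n → ℝ) :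
    vertSum μ Set.univ n h = ∑ t : LabeledTree A n, weight w t * h (enc join base k₀ n t) := by
  rw [← Finset.sum_fiberwise (s := Finset.univ) (g := enc join base k₀ n)]
  refine Finset.sum_congr rfl fun v _ => ?_
  rw [Set.univ_inter, hlaw, Finset.sum_mul]
  exact Finset.sum_congr rfl fun t ht => by rw [(Finset.mem_filter.1 ht).2]

section

variable [IsFiniteMeasure μ]

theorem measureReal_inter_vert_eq_sum (A : Set Γ.Path) (hA : MeasurableSet A) (n : ℕ)
    (v : Γ.V n) : μ.real (A ∩ {x | x.vert n = v})
      = ∑ e with Γ.src n e = v, μ.real (A ∩ {x | x.edge n = e}) := by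
  rw [← measureReal_biUnion_finset]
  · congr 1
    ext x
    simp only [Set.mem_inter_iff, Set.mem_ofPred_eq, Set.mem_iUnion, Finset.mem_filter,
      Finset.mem_univ, true_and, exists_prop]
    exact ⟨fun h => ⟨_, h.2, h.1, rfl⟩, by rintro ⟨e, h1, h2, rfl⟩; exact ⟨h2, h1⟩⟩
  · intro e _ e' _ hne
    exact Set.disjoint_left.2 fun z hz hz' => hne (hz.2.symm.trans hz'.2)
  · exact fun e _ => hA.inter (measurableSet_edge n {e})

/-- `predMean` is the conditional expectation given the `(n + 1)`-st tail algebra, so integrals over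
its sets do not change. -/
theorem IsCentral.vertSum_predMean (hμ : IsCentral μ) (hr : Γ.InRegular r) {n : ℕ}
    {A : Set Γ.Path} (hA : TailMeasurable (n + 1) A) (h : Γ.V n → ℝ) :
    vertSum μ A (n + 1) (predMean r n h) = vertSum μ A n h := by
  have hrn : (r n : ℝ) ≠ 0 := by exact_mod_cast (hr.pos n).ne'
  have hedge : ∀ e : Γ.E n, μ.real (A ∩ {x | x.vert (n + 1) = Γ.tgt n e})
      = r n * μ.real (A ∩ {x | x.edge n = e}) := fun e => by
    rw [Measure.real, ← hμ.measure_inter_edge hr hA, ENNReal.toReal_mul]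
    simp [Measure.real]
  calc vertSum μ A (n + 1) (predMean r n h)
      = ∑ v, ∑ e with Γ.tgt n e = v, μ.real (A ∩ {x | x.edge n = e}) * h (Γ.src n e) := by
        refine Finset.sum_congr rfl fun v _ => ?_
        rw [predMean, Finset.sum_div, Finset.mul_sum]
        refine Finset.sum_congr rfl fun e he => ?_
        rw [← (Finset.mem_filter.1 he).2, hedge]
        field_simp
    _ = ∑ v, ∑ e with Γ.src n e = v, μ.real (A ∩ {x | x.edge n = e}) * h (Γ.src n e) := by
        rw [Finset.sum_fiberwise, Finset.sum_fiberwise]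
    _ = vertSum μ A n h := by
        refine Finset.sum_congr rfl fun v _ => ?_
        rw [measureReal_inter_vert_eq_sum A hA.1, Finset.sum_mul]
        exact Finset.sum_congr rfl fun e he => by rw [(Finset.mem_filter.1 he).2]

/-- Cauchy–Schwarz, with `A` of mass at most one. -/
theorem vertSum_sq_le [IsProbabilityMeasure μ] (A : Set Γ.Path) (hA : MeasurableSet A) (n : ℕ)
    (h : Γ.V n → ℝ) : vertSum μ A n h ^ 2 ≤ vertSum μ Set.univ n fun v => h v ^ 2 := by
  have h1 : ∑ v, μ.real (A ∩ {x | x.vert n = v}) ≤ 1 := by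
    rw [← measureReal_biUnion_finset]
    · exact measureReal_le_one
    · intro v _ v' _ hne
      exact Set.disjoint_left.2 fun z hz hz' => hne (hz.2.symm.trans hz'.2)
    · exact fun v _ => hA.inter (measurableSet_vert_eq n v)
  have h2 : ∀ v, μ.real (A ∩ {x | x.vert n = v}) * h v ^ 2
      ≤ μ.real (Set.univ ∩ {x | x.vert n = v}) * h v ^ 2 := fun v =>
    mul_le_mul_of_nonneg_right
      (measureReal_mono (Set.inter_subset_inter_left _ (Set.subset_univ A))) (sq_nonneg _)
  calc vertSum μ A n h ^ 2
      ≤ (∑ v, μ.real (A ∩ {x | x.vert n = v})) * ∑ v, μ.real (A ∩ {x | x.vert n = v}) * h v ^ 2 :=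
        Finset.sum_sq_le_sum_mul_sum_of_sq_le_mul _ (fun _ _ => measureReal_nonneg)
          (fun _ _ => mul_nonneg measureReal_nonneg (sq_nonneg _)) fun _ _ => le_of_eq (by ring)
    _ ≤ 1 * ∑ v, μ.real (Set.univ ∩ {x | x.vert n = v}) * h v ^ 2 :=
        mul_le_mul h1 (Finset.sum_le_sum fun v _ => h2 v)
          (Finset.sum_nonneg fun v _ => mul_nonneg measureReal_nonneg (sq_nonneg _)) zero_le_one
    _ = _ := one_mul _

end

/-- A central measure for which the vertices of the high levels are encoded by trees with independent
labels is ergodic. -/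
theorem IsJoin.isErgodic (hj : Γ.IsJoin r k₀ join) [IsProbabilityMeasure μ] (hμ : IsCentral μ)
    {w : A → ℝ} (hw : ∑ a, w a = 1)
    (hlaw : ∀ n, k₀ ≤ n → ∀ v, μ.real {x | x.vert n = v}
      = ∑ t : LabeledTree A n with enc join base k₀ n t = v, weight w t) : IsErgodic μ := by
  intro B hB
  have hBm := (hB 0).1
  -- Average `h` upwards over `k` levels: the integral over the tail set `B` stays the same, while
  -- the second moment is halved each time.
  have hbound : ∀ (k n : ℕ) (h : Γ.V n → ℝ), k₀ ≤ n → vertSum μ Set.univ n h = 0 →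
      vertSum μ B n h ^ 2 ≤ (1 / 2) ^ k * vertSum μ Set.univ n fun v => h v ^ 2 := by
    intro k
    induction k with
    | zero => intro n h _ _; rw [pow_zero, one_mul]; exact vertSum_sq_le B hBm n h
    | succ k ih =>
      intro n h hn h0
      have hn1 : k₀ ≤ n + 1 := Nat.le_succ_of_le hn
      rw [vertSum_univ n (hlaw n hn)] at h0 ⊢
      have := ih (n + 1) (predMean r n h) hn1 (by
        rw [vertSum_univ _ (hlaw _ hn1), hj.sum_weight_mul_predMean hw hn, h0])
      rw [hμ.vertSum_predMean hj.inRegular (hB (n + 1)), vertSum_univ _ (hlaw _ hn1),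
        hj.sum_weight_mul_predMean_sq hw hn h h0] at this
      refine this.trans_eq ?_
      rw [pow_succ]; ring
  have hzero : ∀ (n : ℕ) (h : Γ.V n → ℝ), k₀ ≤ n → vertSum μ Set.univ n h = 0 →
      vertSum μ B n h = 0 := by
    intro n h hn h0
    have hlim : Tendsto (fun k => (1 / 2 : ℝ) ^ k * vertSum μ Set.univ n fun v => h v ^ 2) atTop
        (𝓝 (0 * vertSum μ Set.univ n fun v => h v ^ 2)) :=
      (tendsto_pow_atTop_nhds_zero_of_lt_one (by norm_num) (by norm_num)).mul_const _
    rw [zero_mul] at hlim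
    exact pow_eq_zero_iff two_ne_zero |>.1
      (le_antisymm (ge_of_tendsto' hlim fun k => hbound k n h hn h0) (sq_nonneg _))
  have hvert : ∀ n, k₀ ≤ n → ∀ v, μ.real (B ∩ {x | x.vert n = v})
      = μ.real B * μ.real {x | x.vert n = v} := by
    intro n hn v
    have htot : ∀ C : Set Γ.Path, MeasurableSet C →
        ∑ u, μ.real (C ∩ {x | x.vert n = u}) = μ.real C := by
      intro C hC
      rw [← measureReal_biUnion_finset]
      · congr 1; ext x; simp
      · intro v _ v' _ hne
        exact Set.disjoint_left.2 fun z hz hz' => hne (hz.2.symm.trans hz'.2)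
      · exact fun v _ => hC.inter (measurableSet_vert_eq n v)
    -- The test function is the centred indicator of `v`; its integral over `B` measures the
    -- dependence between `B` and the vertex.
    have hexp : ∀ C : Set Γ.Path, MeasurableSet C →
        vertSum μ C n (fun u => (if u = v then 1 else 0) - μ.real {x | x.vert n = v})
          = μ.real (C ∩ {x | x.vert n = v}) - μ.real C * μ.real {x | x.vert n = v} := by
      intro C hC
      simp only [vertSum, mul_sub, Finset.sum_sub_distrib, ← Finset.sum_mul, htot C hC]
      simp
    have := hzero n _ hn (by
      rw [hexp _ MeasurableSet.univ, probReal_univ, one_mul, Set.univ_inter, sub_self])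
    rw [hexp B hBm] at this
    linarith
  have hcyl : ∀ n, k₀ ≤ n → ∀ x, μ (B ∩ cylinder n x) = μ B * μ (cylinder n x) := by
    intro n hn x
    have hd : (dim r n : ℝ≥0∞) ≠ 0 := by exact_mod_cast (hj.inRegular.dim_pos n).ne'
    have h1 : μ (B ∩ {z | z.vert n = x.vert n}) = μ B * μ {z | z.vert n = x.vert n} := by
      rw [← ENNReal.toReal_eq_toReal_iff' (measure_ne_top _ _)
        (ENNReal.mul_ne_top (measure_ne_top _ _) (measure_ne_top _ _)), ENNReal.toReal_mul]
      exact hvert n hn _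
    have h2 := hμ.measure_inter_vert hj.inRegular (n := n) (A := Set.univ)
      ⟨MeasurableSet.univ, fun _ _ => Set.subset_univ _⟩ x
    rw [Set.univ_inter, Set.univ_inter] at h2
    rw [hμ.measure_inter_vert hj.inRegular (hB n), h2, mul_left_comm] at h1
    exact (ENNReal.mul_right_inj hd (ENNReal.natCast_ne_top _)).1 h1
  -- Evaluated at `B`, this equality of measures gives `μ B = μ B * μ B`.
  have heq : μ.restrict B = μ B • μ := by
    refine ext_of_generate_finite _ (generateFrom_cylindersFrom k₀) (isPiSystem_cylindersFrom k₀)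
      ?_ ?_
    · rintro _ ⟨m, hm, z, rfl⟩
      rw [Measure.restrict_apply (measurableSet_cylinder m z), Set.inter_comm, hcyl m hm]
      rfl
    · simp
  have hBB := congrArg (fun ν : Measure Γ.Path => ν B) heq
  simp only [Measure.restrict_apply_self, Measure.smul_apply, smul_eq_mul] at hBB
  by_cases h0 : μ B = 0
  · exact .inl h0
  · exact .inr ((ENNReal.mul_right_inj h0 (measure_ne_top _ _)).1
      (by rw [← hBB, mul_one]))

end GradedGraph

/-! ### Independence of the initial metric. -/

namespace GradedGraph

theorem IsAdmissibleMetric.nonneg {X : Type} [MeasurableSpace X] {μ : Measure X} {ρ : X → X → ℝ}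
    (h : IsAdmissibleMetric μ ρ) (x y : X) : 0 ≤ ρ x y := by
  have h1 := h.triangle x y x
  rw [(h.eq_zero_iff x x).2 rfl, h.symm y x] at h1
  linarith

/-- A measurable function with finitely many values is locally constant with respect to an admissible
metric, uniformly on a set of measure close to the full one. -/
theorem IsAdmissibleMetric.exists_le_of_ne {X : Type} [MeasurableSpace X] [StandardBorelSpace X]
    {μ : Measure X} [IsProbabilityMeasure μ] {ρ : X → X → ℝ} (hρ : IsAdmissibleMetric μ ρ)
    {β : Type} [Finite β] {f : X → β} (hf : ∀ b, MeasurableSet (f ⁻¹' {b})) {ε : ℝ≥0∞}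
    (hε : ε ≠ 0) :
    ∃ K : Set X, MeasurableSet K ∧ μ Kᶜ ≤ ε ∧
      ∃ δ : ℝ, 0 < δ ∧ ∀ x ∈ K, ∀ y ∈ K, f x ≠ f y → δ ≤ ρ x y := by
  classical
  obtain ⟨D, hD, hsep⟩ := hρ.separable
  obtain ⟨x₀, hx₀⟩ := hsep.exists
  obtain ⟨d₀, hd₀, -⟩ := hx₀ 1 one_pos
  obtain ⟨d, hd⟩ := hD.exists_eq_range ⟨d₀, hd₀⟩
  -- The distances to a countable dense set map the separable part `X₀` injectively into `ℝ^ℕ`,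
  -- which brings in an honest Polish topology although `ρ` itself is only measurable.
  let Φ : X → ℕ → ℝ := fun x i => ρ x (d i)
  have hρm : ∀ z, Measurable fun x => ρ x z := fun z =>
    hρ.measurable.comp (measurable_id.prodMk measurable_const)
  have hΦ : Measurable Φ := measurable_pi_iff.2 fun i => hρm (d i)
  let X₀ : Set X := {x | ∀ m : ℕ, ∃ i, ρ x (d i) < 1 / ((m : ℝ) + 1)}
  have hX₀m : MeasurableSet X₀ := by
    have : X₀ = ⋂ m : ℕ, ⋃ i, {x | ρ x (d i) < 1 / ((m : ℝ) + 1)} := by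
      ext x; simp [X₀]
    rw [this]
    exact MeasurableSet.iInter fun m => MeasurableSet.iUnion fun i =>
      measurableSet_lt (hρm (d i)) measurable_const
  have hX₀ : μ X₀ᶜ = 0 := by
    rw [← mem_ae_iff]
    filter_upwards [hsep] with x hx m
    obtain ⟨z, hz, h⟩ := hx (1 / ((m : ℝ) + 1)) (by positivity)
    rw [hd] at hz
    obtain ⟨i, rfl⟩ := hz
    exact ⟨i, h⟩
  have hinj : Set.InjOn Φ X₀ := by
    intro x hx y _ hxy
    rw [← hρ.eq_zero_iff]
    refine le_antisymm (le_of_forall_pos_le_add fun η hη => ?_) (hρ.nonneg x y)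
    obtain ⟨m, hm⟩ := exists_nat_one_div_lt (half_pos hη)
    obtain ⟨i, hi⟩ := hx m
    have h1 := hρ.triangle x (d i) y
    have h2 : ρ x (d i) = ρ y (d i) := congrFun hxy i
    rw [hρ.symm (d i) y, ← h2] at h1
    linarith
  have : Fintype β := Fintype.ofFinite β
  have : IsProbabilityMeasure (μ.map Φ) := Measure.isProbabilityMeasure_map hΦ.aemeasurable
  have hcard : (Fintype.card β : ℝ≥0∞) ≠ ∞ := ENNReal.natCast_ne_top _
  have hε' : ε / Fintype.card β ≠ 0 := by simp [hε]
  -- Injective measurable images in standard Borel spaces are measurable (Lusin–Souslin), so inner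
  -- regularity supplies large compact parts of the images of the level sets of `f`.
  have hcpt : ∀ b, ∃ C ⊆ Φ '' (f ⁻¹' {b} ∩ X₀), IsCompact C ∧ MeasurableSet C ∧
      μ.map Φ (Φ '' (f ⁻¹' {b} ∩ X₀) \ C) ≤ ε / Fintype.card β := by
    intro b
    have hm : MeasurableSet (Φ '' (f ⁻¹' {b} ∩ X₀)) :=
      ((hf b).inter hX₀m).image_of_measurable_injOn hΦ (hinj.mono Set.inter_subset_right)
    obtain ⟨C, hC, hCc, hlt⟩ := hm.exists_isCompact_sdiff_lt (μ := μ.map Φ) (measure_ne_top _ _) hε'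
    exact ⟨C, hC, hCc, hCc.measurableSet, hlt.le⟩
  choose C hCsub hCc hCm hCμ using hcpt
  have hCdisj : ∀ b b', b ≠ b' → Disjoint (C b) (C b') := by
    intro b b' hne
    refine Set.disjoint_left.2 fun u hu hu' => hne ?_
    obtain ⟨x, hx, rfl⟩ := hCsub b hu
    obtain ⟨y, hy, hxy⟩ := hCsub b' hu'
    have := hinj hx.2 hy.2 hxy.symm
    subst this
    exact hx.1.symm.trans hy.1
  -- Each coordinate of `Φ` is 1-Lipschitz for `ρ`. If points over two of the compact sets came
  -- arbitrarily close, subsequences of their images would have a common limit in both, contrary to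
  -- disjointness.
  have hδ : ∀ b b', ∃ δ : ℝ, 0 < δ ∧ (b ≠ b' → ∀ x y, Φ x ∈ C b → Φ y ∈ C b' → δ ≤ ρ x y) := by
    intro b b'
    by_contra hcon
    push Not at hcon
    choose hne x y hx hy hlt using fun m : ℕ => hcon (1 / ((m : ℝ) + 1)) (by positivity)
    obtain ⟨u, hu, s, hs, hsu⟩ := (hCc b).tendsto_subseq hx
    obtain ⟨u', hu', s', hs', hsu'⟩ := (hCc b').tendsto_subseq fun m => hy (s m)
    have hsu2 := hsu.comp hs'.tendsto_atTop
    refine Set.disjoint_left.1 (hCdisj b b' (hne 0)) hu ?_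
    convert hu' using 1
    funext i
    have hlim0 : Tendsto (fun m => ρ (x (s (s' m))) (y (s (s' m)))) atTop (𝓝 0) := by
      have h0 : Tendsto (fun m : ℕ => ρ (x m) (y m)) atTop (𝓝 0) :=
        squeeze_zero (fun m => hρ.nonneg _ _) (fun m => (hlt m).le)
          tendsto_one_div_add_atTop_nhds_zero_nat
      exact h0.comp (hs.tendsto_atTop.comp hs'.tendsto_atTop)
    have hlim1 : Tendsto (fun m => Φ (x (s (s' m))) i - Φ (y (s (s' m))) i) atTop
        (𝓝 (u i - u' i)) :=
      ((continuous_apply i).tendsto u |>.comp hsu2).sub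
        ((continuous_apply i).tendsto u' |>.comp hsu')
    have hlim2 : Tendsto (fun m => Φ (x (s (s' m))) i - Φ (y (s (s' m))) i) atTop (𝓝 0) := by
      refine squeeze_zero_norm (fun m => ?_) hlim0
      rw [Real.norm_eq_abs, abs_le]
      have h1 := hρ.triangle (x (s (s' m))) (y (s (s' m))) (d i)
      have h2 := hρ.triangle (y (s (s' m))) (x (s (s' m))) (d i)
      rw [hρ.symm (y (s (s' m))) (x (s (s' m)))] at h2
      constructor <;> simp only [Φ] <;> linarith
    exact sub_eq_zero.1 (tendsto_nhds_unique hlim1 hlim2)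
  choose δ hδpos hδ using hδ
  have hne : Nonempty (β × β) := ⟨(f x₀, f x₀)⟩
  refine ⟨⋃ b, f ⁻¹' {b} ∩ Φ ⁻¹' C b, MeasurableSet.iUnion fun b => (hf b).inter (hΦ (hCm b)), ?_,
    Finset.univ.inf' Finset.univ_nonempty fun p : β × β => δ p.1 p.2, ?_, ?_⟩
  · have hsub : (⋃ b, f ⁻¹' {b} ∩ Φ ⁻¹' C b)ᶜ
        ⊆ X₀ᶜ ∪ ⋃ b, Φ ⁻¹' (Φ '' (f ⁻¹' {b} ∩ X₀) \ C b) := by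
      intro x hx
      by_cases hx0 : x ∈ X₀
      · refine .inr (Set.mem_iUnion.2 ⟨f x, ⟨x, ⟨rfl, hx0⟩, rfl⟩, fun hxC => hx ?_⟩)
        exact Set.mem_iUnion.2 ⟨f x, rfl, hxC⟩
      · exact .inl hx0
    calc μ _ ≤ μ X₀ᶜ + μ (⋃ b, Φ ⁻¹' (Φ '' (f ⁻¹' {b} ∩ X₀) \ C b)) :=
          (measure_mono hsub).trans (measure_union_le _ _)
      _ ≤ 0 + ∑ b, μ (Φ ⁻¹' (Φ '' (f ⁻¹' {b} ∩ X₀) \ C b)) := by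
          rw [hX₀]; exact add_le_add_right (measure_iUnion_fintype_le _ _) _
      _ ≤ 0 + ∑ _b : β, ε / Fintype.card β := by
          refine add_le_add_right (Finset.sum_le_sum fun b _ => ?_) _
          exact (Measure.le_map_apply hΦ.aemeasurable _).trans (hCμ b)
      _ ≤ ε := by
          rw [zero_add, Finset.sum_const, Finset.card_univ, nsmul_eq_mul]
          exact ENNReal.mul_div_le
  · rw [Finset.lt_inf'_iff]
    exact fun p _ => hδpos p.1 p.2
  · intro x hx y hy hxy
    obtain ⟨b, hb, hxC⟩ := Set.mem_iUnion.1 hx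
    obtain ⟨b', hb', hyC⟩ := Set.mem_iUnion.1 hy
    refine (Finset.inf'_le _ (Finset.mem_univ (b, b'))).trans (hδ b b' ?_ x y hxC hyC)
    rintro rfl
    exact hxy (hb.trans hb'.symm)

/-- The error terms depend on one variable each, so their integrals see only the marginals and are
the same for all couplings. No measurability of the costs is required. -/
theorem kantorovich_le {X : Type} [MeasurableSpace X] {c c' : X → X → ℝ≥0∞} {g : X → ℝ≥0∞}
    (hg : Measurable g) {a : ℝ≥0∞} (ha : a ≠ ∞) (h : ∀ x y, a * c x y ≤ c' x y + g x + g y)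
    (α β : Measure X) :
    a * kantorovich c α β ≤ kantorovich c' α β + ∫⁻ x, g x ∂α + ∫⁻ y, g y ∂β := by
  simp only [kantorovich, ENNReal.iInf_add]
  refine le_iInf fun ψ => ?_
  calc a * ⨅ ψ : {ψ : Measure (X × X) // ψ.map Prod.fst = α ∧ ψ.map Prod.snd = β},
        ∫⁻ p, c p.1 p.2 ∂ψ.1
      ≤ a * ∫⁻ p, c p.1 p.2 ∂ψ.1 := mul_le_mul_right (iInf_le _ ψ) a
    _ = ∫⁻ p, a * c p.1 p.2 ∂ψ.1 := (lintegral_const_mul' _ _ ha).symm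
    _ ≤ ∫⁻ p, c' p.1 p.2 + g p.1 + g p.2 ∂ψ.1 := lintegral_mono fun p => h p.1 p.2
    _ = ∫⁻ p, c' p.1 p.2 ∂ψ.1 + ∫⁻ x, g x ∂α + ∫⁻ y, g y ∂β := by
      have h1 : Measurable fun p : X × X => g p.1 := hg.comp measurable_fst
      have h2 : Measurable fun p : X × X => g p.2 := hg.comp measurable_snd
      rw [lintegral_add_right _ h2, lintegral_add_right _ h1, ← lintegral_map hg measurable_fst,
        ← lintegral_map hg measurable_snd, ψ.2.1, ψ.2.2]

variable {Γ : GradedGraph}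

/-- The iterated averages of a function over the classes of the tail filtration. -/
noncomputable def iterMean (g : Γ.Path → ℝ≥0∞) : ℕ → Γ.Path → ℝ≥0∞
  | 0 => g
  | n + 1 => fun x => ∫⁻ y, iterMean g n y ∂condMeasure (n + 1) x

theorem InRegular.measurable_iterMean {r : ℕ → ℕ} (hr : Γ.InRegular r) {g : Γ.Path → ℝ≥0∞}
    (hg : Measurable g) : ∀ n, Measurable (iterMean g n)
  | 0 => hg
  | n + 1 => hr.measurable_lintegral_condMeasure (n + 1) (hr.measurable_iterMean hg n)

theorem IsCentral.lintegral_iterMean {μ : Measure Γ.Path} [IsFiniteMeasure μ] (hμ : IsCentral μ)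
    {r : ℕ → ℕ} (hr : Γ.InRegular r) {g : Γ.Path → ℝ≥0∞} (hg : Measurable g) :
    ∀ n, ∫⁻ x, iterMean g n x ∂μ = ∫⁻ x, g x ∂μ
  | 0 => rfl
  | n + 1 => (hμ.lintegral_lintegral_condMeasure hr (n + 1) (hr.measurable_iterMean hg n)).trans
      (hμ.lintegral_iterMean hr hg n)

/-- A comparison of initial metrics up to a one-variable error survives iteration, with the error
averaged along; by `lintegral_iterMean` its mean does not grow. -/
theorem InRegular.iterDist_le {r : ℕ → ℕ} (hr : Γ.InRegular r) {ρ ρ' : Γ.Path → Γ.Path → ℝ}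
    {g : Γ.Path → ℝ≥0∞} (hg : Measurable g) {a : ℝ≥0∞} (ha : a ≠ ∞)
    (h : ∀ x y, a * ENNReal.ofReal (ρ x y) ≤ ENNReal.ofReal (ρ' x y) + g x + g y) :
    ∀ n x y, a * iterDist ρ n x y ≤ iterDist ρ' n x y + iterMean g n x + iterMean g n y
  | 0 => h
  | n + 1 => fun _ _ => kantorovich_le (hr.measurable_iterMean hg n) ha
      (hr.iterDist_le hg ha h n) _ _

open Classical in
/-- The discrete semimetric of a function: the distance is `0` if the values agree and `1` otherwise. -/
noncomputable def discreteDist {X β : Type} (f : X → β) (x y : X) : ℝ := if f x = f y then 0 else 1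

/-- For a standard central measure, the iterated distances that start from the discrete semimetric of
a function with finitely many values tend to zero in mean. -/
theorem IsStandard.eventually_lintegral_iterDist_le {μ : Measure Γ.Path} [IsProbabilityMeasure μ]
    (hs : IsStandard μ) (hμ : IsCentral μ) {r : ℕ → ℕ} (hr : Γ.InRegular r) {β : Type} [Finite β]
    {f : Γ.Path → β} (hf : ∀ b, MeasurableSet (f ⁻¹' {b})) {ε : ℝ≥0∞} (hε : ε ≠ 0) :
    ∀ᶠ n in atTop, ∫⁻ x, ∫⁻ y, iterDist (discreteDist f) n x y ∂μ ∂μ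
      ≤ ε := by
  obtain ⟨-, ρ, hρ, hlim⟩ := hs
  have hε3 : ε / 3 ≠ 0 := by simp [hε]
  obtain ⟨K, hKm, hK, δ, hδ, hKδ⟩ := hρ.exists_le_of_ne hf hε3
  have hδ0 : ENNReal.ofReal δ ≠ 0 := by simpa using hδ
  have hδt : ENNReal.ofReal δ ≠ ∞ := ENNReal.ofReal_ne_top
  -- On `K` different values of `f` force `ρ ≥ δ`; off `K` the whole bound `δ` is charged to the
  -- error. The third parts of `ε` pay for the `ρ`-term and for the two error terms.
  let g : Γ.Path → ℝ≥0∞ := Kᶜ.indicator fun _ => ENNReal.ofReal δ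
  have hg : Measurable g := measurable_const.indicator hKm.compl
  have hgK : ∫⁻ x, g x ∂μ ≤ ENNReal.ofReal δ * (ε / 3) := by
    rw [lintegral_indicator_const hKm.compl]
    exact mul_le_mul_right hK _
  have hbase : ∀ x y, ENNReal.ofReal δ * ENNReal.ofReal (discreteDist f x y)
      ≤ ENNReal.ofReal (ρ x y) + g x + g y := by
    intro x y
    unfold discreteDist
    split_ifs with h
    · simp
    · rw [ENNReal.ofReal_one, mul_one]
      by_cases hx : x ∈ K
      · by_cases hy : y ∈ K
        · rw [add_assoc]
          exact (ENNReal.ofReal_le_ofReal (hKδ x hx y hy h)).trans le_self_add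
        · have : g y = ENNReal.ofReal δ := Set.indicator_of_mem hy _
          rw [this]; exact le_add_self
      · have : g x = ENNReal.ofReal δ := Set.indicator_of_mem hx _
        rw [this, add_right_comm]; exact le_add_self
  have hmain : ∀ n, ENNReal.ofReal δ *
        ∫⁻ x, ∫⁻ y, iterDist (discreteDist f) n x y ∂μ ∂μ
      ≤ ∫⁻ x, ∫⁻ y, iterDist ρ n x y ∂μ ∂μ + ENNReal.ofReal δ * (ε / 3)
        + ENNReal.ofReal δ * (ε / 3) := by
    intro n
    have hgm := hr.measurable_iterMean hg n
    have hgi : ∫⁻ x, iterMean g n x ∂μ ≤ ENNReal.ofReal δ * (ε / 3) :=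
      (hμ.lintegral_iterMean hr hg n).trans_le hgK
    calc _ = ∫⁻ x, ∫⁻ y, ENNReal.ofReal δ *
          iterDist (discreteDist f) n x y ∂μ ∂μ := by
          rw [← lintegral_const_mul' _ _ hδt]
          exact lintegral_congr fun x => (lintegral_const_mul' _ _ hδt).symm
      _ ≤ ∫⁻ x, ∫⁻ y, (iterDist ρ n x y + iterMean g n x + iterMean g n y) ∂μ ∂μ :=
          lintegral_mono fun x => lintegral_mono fun y => hr.iterDist_le hg hδt hbase n x y
      _ = ∫⁻ x, ∫⁻ y, iterDist ρ n x y ∂μ ∂μ + ∫⁻ x, iterMean g n x ∂μ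
          + ∫⁻ x, iterMean g n x ∂μ := by
          simp_rw [lintegral_add_right _ hgm, lintegral_add_right _ measurable_const,
            lintegral_const, measure_univ, mul_one]
          rw [lintegral_add_right _ hgm]
      _ ≤ _ := by gcongr
  have hev : ∀ᶠ n in atTop, ∫⁻ x, ∫⁻ y, iterDist ρ n x y ∂μ ∂μ ≤ ENNReal.ofReal δ * (ε / 3) :=
    (hlim.eventually_lt_const (pos_iff_ne_zero.2 (mul_ne_zero hδ0 hε3))).mono fun n hn => hn.le
  filter_upwards [hev] with n hn
  rw [← ENNReal.mul_le_mul_iff_right hδ0 hδt]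
  refine (hmain n).trans ?_
  calc _ ≤ ENNReal.ofReal δ * (ε / 3) + ENNReal.ofReal δ * (ε / 3)
        + ENNReal.ofReal δ * (ε / 3) := by gcongr
    _ = ENNReal.ofReal δ * ε := by rw [← mul_add, ← mul_add, ENNReal.add_thirds]

end GradedGraph

/-! ### Kantorovich distance between uniform measures on pairs. -/

namespace GradedGraph

/-- If the laws of `p` under `α` and `β` are the uniform distributions on the pairs `u₁, u₂` and
`v₁, v₂`, and the cost is bounded from below in terms of the values of `p`, then the Kantorovich
distance is bounded from below by the cost of the best matching, here supposed to be the identity. -/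
theorem le_kantorovich_of_matching_le {X V : Type} [MeasurableSpace X] [MeasurableSpace V]
    [DiscreteMeasurableSpace V] [DecidableEq V] {p : X → V} (hp : Measurable p)
    {c : X → X → ℝ≥0∞} {α β : Measure X} [IsProbabilityMeasure α] {u₁ u₂ v₁ v₂ : V}
    (hα : ∀ h : V → ℝ≥0∞, 2 * ∫⁻ x, h (p x) ∂α = h u₁ + h u₂)
    (hβ : ∀ h : V → ℝ≥0∞, 2 * ∫⁻ x, h (p x) ∂β = h v₁ + h v₂)
    {D₁₁ D₁₂ D₂₁ D₂₂ : ℝ}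
    (h₁₁ : ∀ x y, p x = u₁ → p y = v₁ → ENNReal.ofReal D₁₁ ≤ c x y)
    (h₁₂ : ∀ x y, p x = u₁ → p y = v₂ → ENNReal.ofReal D₁₂ ≤ c x y)
    (h₂₁ : ∀ x y, p x = u₂ → p y = v₁ → ENNReal.ofReal D₂₁ ≤ c x y)
    (h₂₂ : ∀ x y, p x = u₂ → p y = v₂ → ENNReal.ofReal D₂₂ ≤ c x y)
    (hD : D₁₁ + D₂₂ ≤ D₁₂ + D₂₁) :
    ENNReal.ofReal ((D₁₁ + D₂₂) / 2) ≤ kantorovich c α β := by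
  refine le_iInf fun ⟨ψ, hψα, hψβ⟩ => ?_
  have hψ : IsProbabilityMeasure ψ := ⟨by
    rw [← Set.preimage_univ (f := Prod.fst (α := X) (β := X)), ← Measure.map_apply measurable_fst
      MeasurableSet.univ, hψα, measure_univ]⟩
  -- Dual potentials certifying that the identity matching is optimal; only the inequality for `D₁₂`
  -- uses `hD`.
  obtain ⟨a₁, a₂, b₁, b₂, e₁₁, e₁₂, e₂₁, e₂₂, hsum⟩ : ∃ a₁ a₂ b₁ b₂ : ℝ, a₁ + b₁ ≤ D₁₁ ∧
      a₁ + b₂ ≤ D₁₂ ∧ a₂ + b₁ ≤ D₂₁ ∧ a₂ + b₂ ≤ D₂₂ ∧ a₁ + a₂ + b₁ + b₂ = D₁₁ + D₂₂ :=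
    ⟨D₁₁, D₂₁, 0, D₂₂ - D₂₁, by linarith, by linarith, by linarith, by linarith, by ring⟩
  obtain ⟨M, ha₁, ha₂, hb₁, hb₂⟩ : ∃ M : ℝ, |a₁| ≤ M ∧ |a₂| ≤ M ∧ |b₁| ≤ M ∧ |b₂| ≤ M :=
    ⟨|a₁| + |a₂| + |b₁| + |b₂|, by
      have := abs_nonneg a₁; have := abs_nonneg a₂; have := abs_nonneg b₁; have := abs_nonneg b₂
      refine ⟨?_, ?_, ?_, ?_⟩ <;> linarith⟩
  rw [abs_le] at ha₁ ha₂ hb₁ hb₂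
  -- The shift by `M` makes the potentials nonnegative. The maximum covers `u₁ = u₂`: all four cost
  -- bounds then hold at that point, so the larger potential is admissible as well.
  let F : V → ℝ≥0∞ := fun u => max (if u = u₁ then ENNReal.ofReal (a₁ + M) else 0)
    (if u = u₂ then ENNReal.ofReal (a₂ + M) else 0)
  let G : V → ℝ≥0∞ := fun v => max (if v = v₁ then ENNReal.ofReal (b₁ + M) else 0)
    (if v = v₂ then ENNReal.ofReal (b₂ + M) else 0)
  have aux : ∀ (u v : V) (a b D : ℝ) (x y : X), a + b ≤ D → -M ≤ a ∧ a ≤ M → -M ≤ b ∧ b ≤ M →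
      (p x = u → p y = v → ENNReal.ofReal D ≤ c x y) →
      (if p x = u then ENNReal.ofReal (a + M) else 0) + (if p y = v then ENNReal.ofReal (b + M) else 0)
        ≤ c x y + ENNReal.ofReal (2 * M) := by
    intro u v a b D x y hab ha hb hc
    split_ifs with hx hy hy
    · rw [← ENNReal.ofReal_add (by linarith) (by linarith)]
      refine le_trans ?_ (add_le_add_left (hc hx hy) _)
      refine le_trans (ENNReal.ofReal_le_ofReal ?_) ENNReal.ofReal_add_le
      linarith
    · rw [add_zero]
      exact (ENNReal.ofReal_le_ofReal (by linarith)).trans le_add_self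
    · rw [zero_add]
      exact (ENNReal.ofReal_le_ofReal (by linarith)).trans le_add_self
    · simp
  have hFG : ∀ x y, F (p x) + G (p y) ≤ c x y + ENNReal.ofReal (2 * M) := by
    intro x y
    have A₁₁ := aux u₁ v₁ a₁ b₁ D₁₁ x y e₁₁ ha₁ hb₁ (h₁₁ x y)
    have A₁₂ := aux u₁ v₂ a₁ b₂ D₁₂ x y e₁₂ ha₁ hb₂ (h₁₂ x y)
    have A₂₁ := aux u₂ v₁ a₂ b₁ D₂₁ x y e₂₁ ha₂ hb₁ (h₂₁ x y)
    have A₂₂ := aux u₂ v₂ a₂ b₂ D₂₂ x y e₂₂ ha₂ hb₂ (h₂₂ x y)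
    rcases max_choice (if p x = u₁ then ENNReal.ofReal (a₁ + M) else 0)
      (if p x = u₂ then ENNReal.ofReal (a₂ + M) else 0) with h | h <;>
    rcases max_choice (if p y = v₁ then ENNReal.ofReal (b₁ + M) else 0)
      (if p y = v₂ then ENNReal.ofReal (b₂ + M) else 0) with h' | h' <;>
    · simp only [F, G, h, h']; assumption
  have hFm : Measurable fun x => F (p x) := (Measurable.of_discrete (f := F)).comp hp
  have hGm : Measurable fun x => G (p x) := (Measurable.of_discrete (f := G)).comp hp
  have hint : ∫⁻ x, F (p x) ∂α + ∫⁻ y, G (p y) ∂β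
      ≤ ∫⁻ q, c q.1 q.2 ∂ψ + ENNReal.ofReal (2 * M) := by
    have hG2 : Measurable fun q : X × X => G (p q.2) := hGm.comp measurable_snd
    calc _ = ∫⁻ q, (F (p q.1) + G (p q.2)) ∂ψ := by
          rw [lintegral_add_right _ hG2, ← hψα, ← hψβ, lintegral_map hFm measurable_fst,
            lintegral_map hGm measurable_snd]
      _ ≤ ∫⁻ q, (c q.1 q.2 + ENNReal.ofReal (2 * M)) ∂ψ := lintegral_mono fun q => hFG q.1 q.2
      _ = _ := by
          rw [lintegral_add_right _ measurable_const, lintegral_const, measure_univ, mul_one]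
  have hlow : ENNReal.ofReal (D₁₁ + D₂₂ + 4 * M)
      ≤ 2 * (∫⁻ x, F (p x) ∂α + ∫⁻ y, G (p y) ∂β) := by
    rw [mul_add, hα, hβ]
    have hF₁ : ENNReal.ofReal (a₁ + M) ≤ F u₁ := by simp [F]
    have hF₂ : ENNReal.ofReal (a₂ + M) ≤ F u₂ := by simp [F]
    have hG₁ : ENNReal.ofReal (b₁ + M) ≤ G v₁ := by simp [G]
    have hG₂ : ENNReal.ofReal (b₂ + M) ≤ G v₂ := by simp [G]
    refine le_trans ?_ (add_le_add (add_le_add hF₁ hF₂) (add_le_add hG₁ hG₂))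
    rw [← ENNReal.ofReal_add (by linarith) (by linarith),
      ← ENNReal.ofReal_add (by linarith) (by linarith),
      ← ENNReal.ofReal_add (by linarith) (by linarith)]
    exact ENNReal.ofReal_le_ofReal (by linarith)
  have hfin : ENNReal.ofReal ((D₁₁ + D₂₂) / 2 + 2 * M)
      ≤ ∫⁻ q, c q.1 q.2 ∂ψ + ENNReal.ofReal (2 * M) := by
    rw [← ENNReal.mul_le_mul_iff_right two_ne_zero ENNReal.ofNat_ne_top]
    refine le_trans ?_ (hlow.trans (mul_le_mul_right hint 2))
    rw [← ENNReal.ofReal_ofNat 2, ← ENNReal.ofReal_mul zero_le_two]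
    exact ENNReal.ofReal_le_ofReal (by linarith)
  rcases le_or_gt ((D₁₁ + D₂₂) / 2) 0 with h0 | h0
  · rw [ENNReal.ofReal_of_nonpos h0]; exact zero_le
  · rw [ENNReal.ofReal_add h0.le (by linarith)] at hfin
    exact (ENNReal.add_le_add_iff_right ENNReal.ofReal_ne_top).1 hfin

theorem le_kantorovich_of_pairs {X V : Type} [MeasurableSpace X] [MeasurableSpace V]
    [DiscreteMeasurableSpace V] [DecidableEq V] {p : X → V} (hp : Measurable p)
    {c : X → X → ℝ≥0∞} {α β : Measure X} [IsProbabilityMeasure α] {u₁ u₂ v₁ v₂ : V}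
    (hα : ∀ h : V → ℝ≥0∞, 2 * ∫⁻ x, h (p x) ∂α = h u₁ + h u₂)
    (hβ : ∀ h : V → ℝ≥0∞, 2 * ∫⁻ x, h (p x) ∂β = h v₁ + h v₂)
    {D₁₁ D₁₂ D₂₁ D₂₂ : ℝ}
    (h₁₁ : ∀ x y, p x = u₁ → p y = v₁ → ENNReal.ofReal D₁₁ ≤ c x y)
    (h₁₂ : ∀ x y, p x = u₁ → p y = v₂ → ENNReal.ofReal D₁₂ ≤ c x y)
    (h₂₁ : ∀ x y, p x = u₂ → p y = v₁ → ENNReal.ofReal D₂₁ ≤ c x y)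
    (h₂₂ : ∀ x y, p x = u₂ → p y = v₂ → ENNReal.ofReal D₂₂ ≤ c x y) :
    ENNReal.ofReal (min ((D₁₁ + D₂₂) / 2) ((D₁₂ + D₂₁) / 2)) ≤ kantorovich c α β := by
  rcases le_total (D₁₁ + D₂₂) (D₁₂ + D₂₁) with h | h
  · exact (ENNReal.ofReal_le_ofReal (min_le_left _ _)).trans
      (le_kantorovich_of_matching_le hp hα hβ h₁₁ h₁₂ h₂₁ h₂₂ h)
  · exact (ENNReal.ofReal_le_ofReal (min_le_right _ _)).trans
      (le_kantorovich_of_matching_le hp hα (fun k => (hβ k).trans (add_comm _ _)) h₁₂ h₁₁ h₂₂ h₂₁ h)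

end GradedGraph

/-! ### Independent random trees do not come close to each other. -/

namespace LabeledTree

variable {A : Type} [DecidableEq A]

/-- The distance between labelled trees. On the levels up to `k₀` it is the discrete distance of the
leftmost labels; higher trees are compared by the best matching of their subtrees. -/
noncomputable def treeDist (k₀ : ℕ) : ∀ {n}, LabeledTree A n → LabeledTree A n → ℝ
  | 0, s, t => if leaf s = leaf t then 0 else 1
  | n + 1, s, t => if n + 1 ≤ k₀ then (if leaf s = leaf t then 0 else 1) else
      min ((treeDist k₀ s.left t.left + treeDist k₀ s.right t.right) / 2)
        ((treeDist k₀ s.left t.right + treeDist k₀ s.right t.left) / 2)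

theorem treeDist_of_le {k₀ n : ℕ} (h : n ≤ k₀) (s t : LabeledTree A n) :
    treeDist k₀ s t = if leaf s = leaf t then 0 else 1 := by
  cases n with
  | zero => rfl
  | succ n => exact if_pos h

theorem treeDist_succ {k₀ n : ℕ} (h : k₀ ≤ n) (s t : LabeledTree A (n + 1)) :
    treeDist k₀ s t = min ((treeDist k₀ s.left t.left + treeDist k₀ s.right t.right) / 2)
      ((treeDist k₀ s.left t.right + treeDist k₀ s.right t.left) / 2) :=
  if_neg (by omega)

variable [Fintype A]

/-- The exponential at the better matching is at most the sum over both matchings, and for each of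
them the four independent subtrees split into two independent pairs. Doubling `c` absorbs the factor
1/2 in the distance. -/
theorem sum_weight_treeDist_succ_le {w : A → ℝ} (hw : ∀ a, 0 ≤ w a) {k₀ n : ℕ} (hn : k₀ ≤ n)
    (c : ℝ) :
    ∑ s : LabeledTree A (n + 1), ∑ t : LabeledTree A (n + 1),
        weight w s * weight w t * Real.exp (-(2 * c * treeDist k₀ s t))
      ≤ 2 * (∑ s : LabeledTree A n, ∑ t : LabeledTree A n,
        weight w s * weight w t * Real.exp (-(c * treeDist k₀ s t))) ^ 2 := by
  have hexp : ∀ s t : LabeledTree A (n + 1), Real.exp (-(2 * c * treeDist k₀ s t))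
      ≤ Real.exp (-(c * treeDist k₀ s.left t.left)) * Real.exp (-(c * treeDist k₀ s.right t.right))
      + Real.exp (-(c * treeDist k₀ s.left t.right)) * Real.exp (-(c * treeDist k₀ s.right t.left)) := by
    intro s t
    rw [treeDist_succ hn, ← Real.exp_add, ← Real.exp_add]
    rcases min_choice ((treeDist k₀ s.left t.left + treeDist k₀ s.right t.right) / 2)
      ((treeDist k₀ s.left t.right + treeDist k₀ s.right t.left) / 2) with h | h <;> rw [h]
    · refine le_add_of_le_of_nonneg (Real.exp_le_exp.2 (by linarith)) (Real.exp_nonneg _)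
    · refine le_add_of_nonneg_of_le (Real.exp_nonneg _) (Real.exp_le_exp.2 (by linarith))
  let f : LabeledTree A n → LabeledTree A n → ℝ := fun a b =>
    weight w a * weight w b * Real.exp (-(c * treeDist k₀ a b))
  calc _ ≤ ∑ s : LabeledTree A (n + 1), ∑ t : LabeledTree A (n + 1),
        (f s.left t.left * f s.right t.right + f s.left t.right * f s.right t.left) := by
        refine Finset.sum_le_sum fun s _ => Finset.sum_le_sum fun t _ => ?_
        refine (mul_le_mul_of_nonneg_left (hexp s t)
          (mul_nonneg (weight_nonneg hw s) (weight_nonneg hw t))).trans_eq ?_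
        change weight w s.left * weight w s.right * (weight w t.left * weight w t.right) * _ = _
        simp only [f]
        ring
    _ = ∑ a, ∑ b, ∑ c, ∑ d, (f a c * f b d + f a d * f b c) := by
        rw [sum_succ]
        refine Finset.sum_congr rfl fun a _ => Finset.sum_congr rfl fun b _ => ?_
        rw [sum_succ]
        rfl
    _ = 2 * (∑ a, ∑ b, f a b) ^ 2 := by
        have h1 : ∀ a b, ∑ c, ∑ d, (f a c * f b d + f a d * f b c)
            = 2 * ((∑ c, f a c) * ∑ d, f b d) := by
          intro a b
          simp_rw [Finset.sum_add_distrib]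
          rw [Finset.sum_comm (f := fun c d => f a d * f b c), ← Finset.sum_mul_sum]
          ring
        rw [sq, Finset.sum_mul_sum, Finset.mul_sum]
        exact Finset.sum_congr rfl fun a _ => by
          rw [Finset.mul_sum]
          exact Finset.sum_congr rfl fun b _ => h1 a b

/-- Independent random trees with three equally probable labels stay at a positive distance. -/
theorem one_div_le_sum_weight_treeDist {k₀ n : ℕ} (hn : k₀ ≤ n) :
    1 / 18 ≤ ∑ s : LabeledTree (Fin 3) n, ∑ t : LabeledTree (Fin 3) n,
      weight (fun _ => (1 / 3 : ℝ)) s * weight (fun _ => (1 / 3 : ℝ)) t * treeDist k₀ s t := by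
  have hw : ∑ _a : Fin 3, (1 / 3 : ℝ) = 1 := by norm_num
  have hw0 : ∀ a : Fin 3, 0 ≤ (fun _ => (1 / 3 : ℝ)) a := fun _ => by norm_num
  obtain ⟨m, rfl⟩ := Nat.exists_eq_add_of_le hn
  -- Twice the moment is at most squared at each level, so it must start below 1. Three labels agree
  -- with probability 1/3 and `exp (-3) ≤ 1/8`, whence `2 * (1/3 + 2/3 * 1/8) = 5/6`; with two
  -- equally likely labels it would exceed 1.
  have hmom : ∑ s : LabeledTree (Fin 3) (k₀ + m), ∑ t : LabeledTree (Fin 3) (k₀ + m),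
      weight (fun _ => (1 / 3 : ℝ)) s * weight (fun _ => (1 / 3 : ℝ)) t *
        Real.exp (-(3 * 2 ^ m * treeDist k₀ s t)) ≤ 1 / 2 * (5 / 6) ^ 2 ^ m := by
    clear hn
    induction m with
    | zero =>
      have h3 : Real.exp (-3) ≤ 1 / 8 := by
        rw [Real.exp_neg, ← one_div]
        refine one_div_le_one_div_of_le (by norm_num) ?_
        have h2 : (2 : ℝ) ≤ Real.exp 1 := by linarith [Real.add_one_le_exp (1 : ℝ)]
        calc (8 : ℝ) = 2 ^ 3 := by norm_num
          _ ≤ Real.exp 1 ^ 3 := pow_le_pow_left₀ (by norm_num) h2 3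
          _ = Real.exp 3 := by rw [← Real.exp_nat_mul]; norm_num
      have h1 : ∀ a : Fin 3, ∑ t : LabeledTree (Fin 3) k₀, weight (fun _ => (1 / 3 : ℝ)) t *
          Real.exp (-(3 * 2 ^ 0 * if a = leaf t then 0 else 1))
          = 1 / 3 + 2 / 3 * Real.exp (-3) := by
        intro a
        rw [sum_weight_mul_leaf hw k₀ fun b => Real.exp (-(3 * 2 ^ 0 * if a = b then 0 else 1))]
        fin_cases a <;> simp [Fin.sum_univ_three] <;> ring
      simp only [Nat.add_zero, treeDist_of_le le_rfl, mul_assoc, ← Finset.mul_sum] at h1 ⊢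
      simp_rw [h1, ← Finset.sum_mul, sum_weight hw]
      norm_num
      linarith
    | succ m ih =>
      have h := sum_weight_treeDist_succ_le hw0 (Nat.le_add_right k₀ m) (3 * 2 ^ m)
      have e : (2 : ℝ) * (3 * 2 ^ m) = 3 * 2 ^ (m + 1) := by ring
      rw [e] at h
      have h0 : 0 ≤ ∑ s : LabeledTree (Fin 3) (k₀ + m), ∑ t : LabeledTree (Fin 3) (k₀ + m),
          weight (fun _ => (1 / 3 : ℝ)) s * weight (fun _ => (1 / 3 : ℝ)) t *
            Real.exp (-(3 * 2 ^ m * treeDist k₀ s t)) :=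
        Finset.sum_nonneg fun s _ => Finset.sum_nonneg fun t _ =>
          mul_nonneg (mul_nonneg (weight_nonneg hw0 s) (weight_nonneg hw0 t)) (Real.exp_nonneg _)
      refine h.trans ((mul_le_mul_of_nonneg_left (pow_le_pow_left₀ h0 ih 2) zero_le_two).trans_eq ?_)
      rw [mul_pow, ← pow_mul, ← pow_succ]
      ring
  let T := LabeledTree (Fin 3) (k₀ + m)
  let W : T × T → ℝ := fun q => weight (fun _ => (1 / 3 : ℝ)) q.1 * weight (fun _ => (1 / 3 : ℝ)) q.2
  let D : T × T → ℝ := fun q => treeDist k₀ q.1 q.2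
  have hWn : ∀ q ∈ (Finset.univ : Finset (T × T)), 0 ≤ W q := fun q _ =>
    mul_nonneg (weight_nonneg hw0 q.1) (weight_nonneg hw0 q.2)
  have hW : ∑ q, W q = 1 := by
    rw [Fintype.sum_prod_type]
    simp only [W, ← Finset.sum_mul_sum]
    rw [sum_weight hw, one_mul]
  have hmom' : ∑ q, W q * Real.exp (-(3 * D q)) ^ 2 ^ m ≤ 1 / 2 * (5 / 6) ^ 2 ^ m := by
    refine le_trans (le_of_eq ?_) hmom
    rw [Fintype.sum_prod_type]
    refine Finset.sum_congr rfl fun s _ => Finset.sum_congr rfl fun t _ => ?_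
    rw [← Real.exp_nat_mul]
    push_cast
    simp only [W, D]
    congr 2
    ring
  -- Taking the root of order `2 ^ m` returns to the fixed exponent 3. Then `exp (-3 D) ≥ 1 - 3 D`
  -- gives mean distance at least `(1 - 5/6) / 3 = 1/18`.
  have hjensen := Real.pow_arith_mean_le_arith_mean_pow Finset.univ W
    (fun q => Real.exp (-(3 * D q))) hWn hW (fun q _ => Real.exp_nonneg _) (2 ^ m)
  have hmean : ∑ q, W q * Real.exp (-(3 * D q)) ≤ 5 / 6 := by
    refine le_of_pow_le_pow_left₀ (n := 2 ^ m) (by positivity) (by norm_num)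
      (hjensen.trans (hmom'.trans ?_))
    have : (0 : ℝ) ≤ (5 / 6) ^ 2 ^ m := by positivity
    linarith
  have hlin : 1 - 3 * ∑ q, W q * D q ≤ ∑ q, W q * Real.exp (-(3 * D q)) := by
    calc 1 - 3 * ∑ q, W q * D q = ∑ q, (W q - 3 * (W q * D q)) := by
          rw [Finset.sum_sub_distrib, hW, Finset.mul_sum]
      _ = ∑ q, W q * (1 - 3 * D q) :=
          Finset.sum_congr rfl fun q _ => by ring
      _ ≤ _ := Finset.sum_le_sum fun q hq => mul_le_mul_of_nonneg_left
          (by linarith [Real.add_one_le_exp (-(3 * D q))]) (hWn q hq)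
  have hfin : ∑ q, W q * D q = ∑ s : T, ∑ t : T,
      weight (fun _ => (1 / 3 : ℝ)) s * weight (fun _ => (1 / 3 : ℝ)) t * treeDist k₀ s t :=
    Fintype.sum_prod_type _
  rw [← hfin]
  linarith

end LabeledTree

/-! ### Failure of standardness in graphs with joins. -/

theorem ENNReal.ofReal_sum_le_sum_ofReal {ι : Type} (s : Finset ι) (f : ι → ℝ) :
    ENNReal.ofReal (∑ i ∈ s, f i) ≤ ∑ i ∈ s, ENNReal.ofReal (f i) :=
  Finset.le_sum_of_subadditive _ ENNReal.ofReal_zero.le (fun _ _ => ENNReal.ofReal_add_le) s f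

namespace GradedGraph

variable {Γ : GradedGraph} {r : ℕ → ℕ} {k₀ : ℕ} {join : ∀ n, Γ.V n → Γ.V n → Γ.V (n + 1)}
  {A : Type} {base : ∀ n, A → Γ.V n} {μ : Measure Γ.Path}

theorem IsJoin.exists_mem_Erg [Fintype A] (hj : Γ.IsJoin r k₀ join) (base : ∀ n, A → Γ.V n)
    {w : A → ℝ≥0} (hw : ∑ a, w a = 1) :
    ∃ μ ∈ Erg Γ, ∀ n, k₀ ≤ n → ∀ v,
      μ {x | x.vert n = v} = encLaw join base k₀ (fun a => (w a : ℝ≥0∞)) n v := by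
  obtain ⟨μ, hμ, hc, hlaw⟩ := hj.exists_measure base (w := fun a => (w a : ℝ≥0∞))
    (by exact_mod_cast congrArg ((↑) : ℝ≥0 → ℝ≥0∞) hw)
  refine ⟨μ, ⟨hμ, hc, hj.isErgodic (base := base) hc (w := fun a => (w a : ℝ))
    (by exact_mod_cast congrArg ((↑) : ℝ≥0 → ℝ) hw) fun n hn v => ?_⟩, hlaw⟩
  have h1 : ∀ t : LabeledTree A n, weight (fun a => (w a : ℝ≥0∞)) t = (weight w t : ℝ≥0) :=
    fun t => (map_weight ENNReal.ofNNRealHom w t).symm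
  have h2 : ∀ t : LabeledTree A n, weight (fun a => (w a : ℝ)) t = (weight w t : ℝ≥0) :=
    fun t => (map_weight NNReal.toRealHom w t).symm
  simp_rw [Measure.real, hlaw n hn, encLaw, h1, h2]
  rw [← ENNReal.ofNNReal_finsetSum, ENNReal.coe_toReal, NNReal.coe_sum]

/-- The vertex of level `k₀` is constant on the classes of `ξ_n` for `n ≤ k₀`, so averaging over
these classes does not reduce the distance. -/
theorem ofReal_discreteDist_le_iterDist (x y : Γ.Path) {n : ℕ} (hn : n ≤ k₀) :
    ENNReal.ofReal (discreteDist (fun x : Γ.Path => x.vert k₀) x y)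
      ≤ iterDist (discreteDist fun x : Γ.Path => x.vert k₀) n x y := by
  induction n generalizing x y with
  | zero => exact le_rfl
  | succ n ih =>
    refine le_iInf fun ⟨ψ, hψx, hψy⟩ => ?_
    have := isProbabilityMeasure_condMeasure (n + 1) x
    have := isProbabilityMeasure_condMeasure (n + 1) y
    have hψ : IsProbabilityMeasure ψ := ⟨by
      rw [← Set.preimage_univ (f := Prod.fst (α := Γ.Path) (β := Γ.Path)),
        ← Measure.map_apply measurable_fst MeasurableSet.univ, hψx, measure_univ]⟩
    have hclass : ∀ z : Γ.Path, ∀ᵐ z' ∂condMeasure (n + 1) z, z'.vert k₀ = z.vert k₀ := by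
      intro z
      have hmem : ∀ᵐ z' ∂condMeasure (n + 1) z, z' ∈ tailClass (n + 1) z :=
        ProbabilityTheory.ae_cond_mem (finite_tailClass (n + 1) z).measurableSet
      exact hmem.mono fun z' hz' => vert_eq_of_mem_tailClass hz' hn
    have hx : ∀ᵐ q ∂ψ, q.1.vert k₀ = x.vert k₀ :=
      ae_of_ae_map measurable_fst.aemeasurable (by rw [hψx]; exact hclass x)
    have hy : ∀ᵐ q ∂ψ, q.2.vert k₀ = y.vert k₀ :=
      ae_of_ae_map measurable_snd.aemeasurable (by rw [hψy]; exact hclass y)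
    calc ENNReal.ofReal (discreteDist (fun x : Γ.Path => x.vert k₀) x y)
        = ∫⁻ _q, ENNReal.ofReal (discreteDist (fun x : Γ.Path => x.vert k₀) x y) ∂ψ := by
          rw [lintegral_const, measure_univ, mul_one]
      _ ≤ _ := by
          refine lintegral_mono_ae ?_
          filter_upwards [hx, hy] with q h1 h2
          refine le_trans (le_of_eq ?_) (ih q.1 q.2 (by omega))
          simp only [discreteDist, h1, h2]

/-- Under the conditional measure of level `n + 1` the preceding vertex is uniform on the two
encoded subtrees, so the Kantorovich step is a matching of pairs, as in `treeDist`. The bound holds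
for every choice of encoding trees, so `enc` need not be injective above `k₀`. -/
theorem IsJoin.ofReal_treeDist_le_iterDist [DecidableEq A] (hj : Γ.IsJoin r k₀ join)
    (hbase : Function.Injective (base k₀)) {n : ℕ} (hn : k₀ ≤ n) (s t : LabeledTree A n)
    (x y : Γ.Path) (hx : x.vert n = enc join base k₀ n s) (hy : y.vert n = enc join base k₀ n t) :
    ENNReal.ofReal (treeDist k₀ s t)
      ≤ iterDist (discreteDist fun x : Γ.Path => x.vert k₀) n x y := by
  induction n, hn using Nat.le_induction generalizing x y with
  | base =>
    refine le_trans (le_of_eq ?_) (ofReal_discreteDist_le_iterDist x y le_rfl)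
    rw [enc_of_le le_rfl] at hx hy
    simp only [discreteDist, treeDist_of_le le_rfl, hx, hy, hbase.eq_iff]
  | succ n hn ih =>
    have hmean : ∀ (z : Γ.Path) (u : LabeledTree A (n + 1)), z.vert (n + 1) = enc join base k₀ (n + 1) u →
        ∀ h : Γ.V n → ℝ≥0∞, 2 * ∫⁻ z', h (z'.vert n) ∂condMeasure (n + 1) z
          = h (enc join base k₀ n u.left) + h (enc join base k₀ n u.right) := by
      intro z u hz h
      have hrn : (r n : ℝ≥0∞) ≠ 0 := by exact_mod_cast (hj.inRegular.pos n).ne'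
      rw [← ENNReal.mul_right_inj hrn (ENNReal.natCast_ne_top _), mul_left_comm,
        hj.inRegular.lintegral_condMeasure_vert, hz, enc_succ hn, hj.sum_src hn]
    have := isProbabilityMeasure_condMeasure (n + 1) x
    rw [treeDist_succ hn]
    exact le_kantorovich_of_pairs (measurable_vert n) (hmean x s hx) (hmean y t hy)
      (fun x' y' => ih s.left t.left x' y') (fun x' y' => ih s.left t.right x' y')
      (fun x' y' => ih s.right t.left x' y') (fun x' y' => ih s.right t.right x' y')

theorem lintegral_vert (μ : Measure Γ.Path) (n : ℕ) (h : Γ.V n → ℝ≥0∞) :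
    ∫⁻ x, h (x.vert n) ∂μ = ∑ v, μ {x | x.vert n = v} * h v := by
  rw [lintegral_eq_sum_vert μ n]
  refine Finset.sum_congr rfl fun v _ => ?_
  rw [setLIntegral_congr_fun (g := fun _ => h v) (measurableSet_vert_eq n v)
    (fun x hx => congrArg h hx), setLIntegral_const, mul_comm]

/-- If three vertices of some level can be distinguished, then the graph has an ergodic central
measure that is not standard. -/
theorem IsJoin.exists_not_isStandard (hj : Γ.IsJoin r k₀ join) (base : ∀ n, Fin 3 → Γ.V n)
    (hbase : Function.Injective (base k₀)) : ∃ μ ∈ Erg Γ, ¬ IsStandard μ := by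
  obtain ⟨μ, hμ, hlaw⟩ := hj.exists_mem_Erg base (w := fun _ => 1 / 3) (by
    rw [Finset.sum_const, Finset.card_univ, Fintype.card_fin, nsmul_eq_mul]
    norm_num)
  refine ⟨μ, hμ, fun hs => ?_⟩
  have := hμ.1
  obtain ⟨n, hle, hn⟩ := ((hs.eventually_lintegral_iterDist_le hμ.2.1 hj.inRegular
    (f := fun x : Γ.Path => x.vert k₀) (fun b => measurableSet_vert_eq k₀ b)
    (ε := ENNReal.ofReal (1 / 36)) (by simp)).and (eventually_ge_atTop k₀)).exists
  let W : LabeledTree (Fin 3) n → ℝ := weight fun _ => 1 / 3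
  have hW : ∀ t, 0 ≤ W t := weight_nonneg fun _ => by norm_num
  have hweight : ∀ t : LabeledTree (Fin 3) n,
      weight (fun _ => (((1 / 3 : ℝ≥0)) : ℝ≥0∞)) t = ENNReal.ofReal (W t) := by
    intro t
    have h2 : W t = (weight (fun _ => (1 / 3 : ℝ≥0)) t : ℝ≥0) := by
      rw [show ((weight (fun _ => (1 / 3 : ℝ≥0)) t : ℝ≥0) : ℝ)
        = NNReal.toRealHom (weight (fun _ => (1 / 3 : ℝ≥0)) t) from rfl, map_weight]
      simp [W]
    rw [h2, ENNReal.ofReal_coe_nnreal]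
    exact (map_weight ENNReal.ofNNRealHom _ t).symm
  let E : LabeledTree (Fin 3) n → Γ.V n := enc join base k₀ n
  -- The supremum over encoding trees turns the lower bound into a function of the two vertices; its
  -- integral is a finite sum, and measurability of `iterDist` is never needed.
  let H : Γ.V n → Γ.V n → ℝ≥0∞ := fun u v =>
    ⨆ (s) (_ : E s = u) (t) (_ : E t = v), ENNReal.ofReal (treeDist k₀ s t)
  have hH : ∀ x y : Γ.Path, H (x.vert n) (y.vert n)
      ≤ iterDist (discreteDist fun x : Γ.Path => x.vert k₀) n x y := fun x y =>
    iSup₂_le fun s hs => iSup₂_le fun t ht =>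
      hj.ofReal_treeDist_le_iterDist hbase hn s t x y hs.symm ht.symm
  have hlint : ∀ h : Γ.V n → ℝ≥0∞, ∫⁻ x, h (x.vert n) ∂μ
      = ∑ t, ENNReal.ofReal (W t) * h (E t) := by
    intro h
    rw [lintegral_vert]
    simp_rw [hlaw n hn, ← hweight]
    exact sum_encLaw_mul n h
  have hlow : ENNReal.ofReal (1 / 18)
      ≤ ∫⁻ x, ∫⁻ y, iterDist (discreteDist fun x : Γ.Path => x.vert k₀) n x y ∂μ ∂μ := by
    calc ENNReal.ofReal (1 / 18)
        ≤ ENNReal.ofReal (∑ s, ∑ t, W s * W t * treeDist k₀ s t) :=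
          ENNReal.ofReal_le_ofReal (one_div_le_sum_weight_treeDist hn)
      _ ≤ ∑ s, ∑ t, ENNReal.ofReal (W s * W t * treeDist k₀ s t) :=
          (ENNReal.ofReal_sum_le_sum_ofReal _ _).trans
            (Finset.sum_le_sum fun s _ => ENNReal.ofReal_sum_le_sum_ofReal _ _)
      _ ≤ ∑ s, ENNReal.ofReal (W s) * ∑ t, ENNReal.ofReal (W t) * H (E s) (E t) := by
          refine Finset.sum_le_sum fun s _ => ?_
          rw [Finset.mul_sum]
          refine Finset.sum_le_sum fun t _ => ?_
          rw [mul_assoc, ENNReal.ofReal_mul (hW s), ENNReal.ofReal_mul (hW t)]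
          gcongr
          exact le_iSup₂_of_le s rfl (le_iSup₂_of_le t rfl le_rfl)
      _ = ∫⁻ x, ∫⁻ y, H (x.vert n) (y.vert n) ∂μ ∂μ := by
          rw [hlint fun u => ∫⁻ y, H u (y.vert n) ∂μ]
          exact Finset.sum_congr rfl fun s _ => by rw [hlint (H (E s))]
      _ ≤ _ := lintegral_mono fun x => lintegral_mono fun y => hH x y
  have hcon := hlow.trans hle
  rw [ENNReal.ofReal_le_ofReal_iff (by norm_num)] at hcon
  norm_num at hcon

end GradedGraph

/-! ### The graph of unordered pairs and its telescopings. -/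

namespace GradedGraph

/-- The vertex `{u, v}` of the level above `u` and `v`. -/
def upPair : ∀ n, UP.V n → UP.V n → UP.V (n + 1)
  | 0, _, _ => (false : Bool)
  | n + 1, u, v => (s(u, v) : Sym2 (UPVertex (n + 1)))

theorem sum_src_upPair {n : ℕ} (hn : n ≠ 0) (u v : UP.V n) (h : UP.V n → ℕ) :
    ∑ e with UP.tgt n e = upPair n u v, h (UP.src n e) = h u + h v := by
  classical
  obtain ⟨n, rfl⟩ := Nat.exists_eq_succ_of_ne_zero hn
  let e₁ : UP.E (n + 1) := (⟨(u, s(u, v), false), Sym2.mem_mk_left u v, fun h => by cases h⟩ :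
    UPEdge (n + 1))
  -- The flag is set exactly on the diagonal, where it separates the second copy of the doubled edge
  -- from `e₁`.
  let e₂ : UP.E (n + 1) := (⟨(v, s(u, v), decide (u = v)), Sym2.mem_mk_right u v,
    fun h => Sym2.mk_isDiag_iff.2 (of_decide_eq_true h)⟩ : UPEdge (n + 1))
  have hne : e₁ ≠ e₂ := by
    intro he
    have h1 : u = v := congrArg (fun e : UPEdge (n + 1) => e.1.1) he
    have h2 : false = decide (u = v) := congrArg (fun e : UPEdge (n + 1) => e.1.2.2) he
    simp [h1] at h2
  have hset : (Finset.univ.filter fun e => UP.tgt (n + 1) e = upPair (n + 1) u v) = {e₁, e₂} := by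
    ext e
    rw [Finset.mem_filter, Finset.mem_insert, Finset.mem_singleton]
    constructor
    · rintro ⟨-, he⟩
      obtain ⟨⟨w, p, b⟩, hw, hb⟩ := (e : UPEdge (n + 1))
      have hp : p = s(u, v) := he
      subst hp
      by_cases huv : u = v
      · subst huv
        have hwu : w = u := (Sym2.mem_iff.1 hw).elim id id
        subst hwu
        cases b
        · exact .inl rfl
        · exact .inr (Subtype.ext (Prod.ext rfl (Prod.ext rfl (decide_eq_true rfl).symm)))
      · have hbf : b = false := by
          by_contra hb'
          exact huv (Sym2.mk_isDiag_iff.1 (hb (Bool.eq_true_of_not_eq_false hb')))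
        subst hbf
        rcases Sym2.mem_iff.1 hw with h | h
        · exact .inl (Subtype.ext (Prod.ext h rfl))
        · exact .inr (Subtype.ext (Prod.ext h (Prod.ext rfl (decide_eq_false huv).symm)))
    · rintro (rfl | rfl)
      · exact ⟨Finset.mem_univ _, rfl⟩
      · exact ⟨Finset.mem_univ _, rfl⟩
  rw [hset, Finset.sum_pair hne]
  rfl

/-- The number of edges to a vertex of level `n + 1` of the graph of unordered pairs. -/
def upInDegree (n : ℕ) : ℕ := if n = 0 then 1 else 2

theorem upInDegree_of_ne_zero {n : ℕ} (hn : n ≠ 0) : upInDegree n = 2 := if_neg hn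

theorem inRegular_UP : UP.InRegular upInDegree := by
  intro n v
  cases n with
  | zero =>
    refine Finset.card_eq_one.2 ⟨show UP.E 0 from v, ?_⟩
    ext e
    rw [Finset.mem_filter, Finset.mem_singleton]
    exact ⟨fun h => h.2, fun h => ⟨Finset.mem_univ _, h⟩⟩
  | succ n =>
    obtain ⟨u, u', rfl⟩ : ∃ u u', upPair (n + 1) u u' = v := by
      induction v using Sym2.ind with
      | _ u u' => exact ⟨u, u', rfl⟩
    have := sum_src_upPair n.succ_ne_zero u u' fun _ => 1
    rw [Finset.sum_const, smul_eq_mul, mul_one] at this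
    exact this

theorem isJoin_UP {k₀ : ℕ} (hk : k₀ ≠ 0) : UP.IsJoin upInDegree k₀ upPair where
  inRegular := inRegular_UP
  sum_src_nat n hn u v h := by
    have hn0 : n ≠ 0 := by omega
    rw [upInDegree_of_ne_zero hn0, sum_src_upPair hn0]

theorem exists_base {Γ : GradedGraph} {A : Type} (k : ℕ) (f : A → Γ.V k) :
    ∃ base : ∀ n, A → Γ.V n, base k = f := by
  choose x hx using fun a => exists_path_vert k (f a)
  exact ⟨fun n a => (x a).vert n, funext hx⟩

/-- The labels are the vertices of level `n` themselves, with weights `p`, and `k₀ = n`. -/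
theorem IsJoin.exists_mem_Erg_vert {Γ : GradedGraph} {r : ℕ → ℕ} {n : ℕ}
    {join : ∀ n, Γ.V n → Γ.V n → Γ.V (n + 1)} (hj : Γ.IsJoin r n join) (p : PMF (Γ.V n)) :
    ∃ μ ∈ Erg Γ, ∀ v, μ {x | x.vert n = v} = p v := by
  have hp : ∀ v, ((p v).toNNReal : ℝ≥0∞) = p v := fun v => ENNReal.coe_toNNReal (p.apply_ne_top v)
  have hs : ∑ v, ((p v).toNNReal : ℝ≥0∞) = 1 := by
    simp_rw [hp]
    rw [← p.tsum_coe, tsum_fintype]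
  have hsum : ∑ v, (p v).toNNReal = 1 := by
    rw [← ENNReal.coe_inj, ENNReal.ofNNReal_finsetSum, hs, ENNReal.coe_one]
  obtain ⟨base, hbase⟩ := exists_base (Γ := Γ) n id
  obtain ⟨μ, hμ, hlaw⟩ := hj.exists_mem_Erg base hsum
  refine ⟨μ, hμ, fun v => ?_⟩
  rw [hlaw n le_rfl, encLaw_self hs, hbase]
  simp [hp, Finset.sum_filter]

theorem exists_mem_Erg_UP (n : ℕ) (p : PMF (UP.V n)) :
    ∃ μ ∈ Erg UP, ∀ v, μ {x | x.vert n = v} = p v := by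
  rcases eq_or_ne n 0 with rfl | hn
  · obtain ⟨μ, hμ, -⟩ := (isJoin_UP one_ne_zero).exists_mem_Erg_vert
      (PMF.pure (show UP.V 1 from (false : Bool)))
    have := hμ.1
    refine ⟨μ, hμ, fun v => ?_⟩
    have h1 : {x : UP.Path | x.vert 0 = v} = Set.univ := Set.eq_univ_of_forall fun x => rfl
    have h2 : ∑' u, p u = p v := tsum_eq_single v fun u hu => absurd rfl hu
    rw [h1, measure_univ, ← h2, p.tsum_coe]
  · exact (isJoin_UP hn).exists_mem_Erg_vert p

section Segment

variable {Γ : GradedGraph} {i m : ℕ}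

instance (i m : ℕ) : Finite (Γ.Segment i m) := by
  unfold Segment
  infer_instance

noncomputable instance (i m : ℕ) : Fintype (Γ.Segment i m) := Fintype.ofFinite _

/-- A finite path without its last edge. -/
def Segment.init (p : Γ.Segment i (m + 1)) : Γ.Segment i m :=
  ⟨fun j => p.1 j.castSucc, fun j => p.2 j.castSucc⟩

/-- The last edge of a finite path. -/
def Segment.lastEdge (p : Γ.Segment i (m + 1)) : Γ.E (i + (m + 1)) := p.1 (Fin.last (m + 1))

theorem Segment.finish_init (p : Γ.Segment i (m + 1)) :
    p.init.finish = Γ.src (i + (m + 1)) p.lastEdge := p.2 (Fin.last m)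

theorem Segment.ext_init {p q : Γ.Segment i (m + 1)} (h : p.init = q.init)
    (h' : p.lastEdge = q.lastEdge) : p = q := by
  refine Subtype.ext (funext fun j => ?_)
  induction j using Fin.lastCases with
  | last => exact h'
  | cast j => exact congrFun (congrArg Subtype.val h) j

theorem Segment.exists_init_eq (q : Γ.Segment i m) (e : Γ.E (i + (m + 1)))
    (h : q.finish = Γ.src (i + (m + 1)) e) :
    ∃ p : Γ.Segment i (m + 1), p.init = q ∧ p.lastEdge = e := by
  let f : ∀ j : Fin (m + 2), Γ.E (i + j) := fun j =>
    Fin.lastCases (motive := fun j : Fin (m + 2) => Γ.E (i + j)) e (fun j => q.1 j) j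
  have hlast : f (Fin.last (m + 1)) = e :=
    Fin.lastCases_last (motive := fun j : Fin (m + 2) => Γ.E (i + j)) (last := e)
      (cast := fun j => q.1 j)
  have hcast : ∀ j : Fin (m + 1), f j.castSucc = q.1 j := fun j =>
    Fin.lastCases_castSucc (motive := fun j : Fin (m + 2) => Γ.E (i + j)) (last := e)
      (cast := fun j => q.1 j) j
  refine ⟨⟨f, fun j => ?_⟩, Subtype.ext (funext hcast), hlast⟩
  induction j using Fin.lastCases with
  | last =>
    exact (congrArg (Γ.tgt (i + m)) (hcast (Fin.last m))).trans
      (h.trans (congrArg (Γ.src (i + (m + 1))) hlast.symm))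
  | cast j =>
    exact (congrArg (Γ.tgt (i + j)) (hcast j.castSucc)).trans
      ((q.2 j).trans (congrArg (Γ.src (i + j + 1)) (hcast j.succ).symm))

theorem sum_segment_zero (h : Γ.V i → ℕ) (v : Γ.V (i + 0 + 1)) :
    ∑ p : Γ.Segment i 0 with p.finish = v, h p.start
      = ∑ e with Γ.tgt i e = v, h (Γ.src i e) := by
  refine Finset.sum_bij (fun p _ => p.1 0) (fun p hp => ?_) (fun p _ q _ hpq => ?_)
    (fun e he => ?_) (fun p _ => rfl)
  · exact Finset.mem_filter.2 ⟨Finset.mem_univ _, (Finset.mem_filter.1 hp).2⟩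
  · refine Subtype.ext (funext fun j => ?_)
    obtain rfl : j = 0 := Fin.ext (Nat.lt_one_iff.1 j.2)
    exact hpq
  · refine ⟨⟨fun j => Fin.cases (motive := fun j : Fin 1 => Γ.E (i + j)) e
      (fun j => j.elim0) j, fun j => j.elim0⟩, ?_, rfl⟩
    exact Finset.mem_filter.2 ⟨Finset.mem_univ _, (Finset.mem_filter.1 he).2⟩

theorem sum_segment_succ (h : Γ.V i → ℕ) (v : Γ.V (i + (m + 1) + 1)) :
    ∑ p : Γ.Segment i (m + 1) with p.finish = v, h p.start
      = ∑ e with Γ.tgt (i + (m + 1)) e = v,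
        ∑ p : Γ.Segment i m with p.finish = Γ.src (i + (m + 1)) e, h p.start := by
  rw [Finset.sum_sigma']
  refine Finset.sum_bij (fun p _ => ⟨p.lastEdge, p.init⟩) (fun p hp => ?_) (fun p _ q _ hpq => ?_)
    (fun ⟨e, q⟩ he => ?_) (fun p _ => rfl)
  · rw [Finset.mem_sigma, Finset.mem_filter, Finset.mem_filter]
    exact ⟨⟨Finset.mem_univ _, (Finset.mem_filter.1 hp).2⟩, Finset.mem_univ _, p.finish_init⟩
  · rw [Sigma.mk.injEq] at hpq
    exact Segment.ext_init (eq_of_heq hpq.2) hpq.1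
  · rw [Finset.mem_sigma, Finset.mem_filter, Finset.mem_filter] at he
    obtain ⟨p, rfl, rfl⟩ := Segment.exists_init_eq q e he.2.2
    exact ⟨p, Finset.mem_filter.2 ⟨Finset.mem_univ _, he.1.2⟩, rfl⟩

theorem InRegular.card_segment {r : ℕ → ℕ} (hr : Γ.InRegular r) (i m : ℕ) (v : Γ.V (i + m + 1)) :
    (Finset.univ.filter fun p : Γ.Segment i m => p.finish = v).card
      = ∏ j ∈ Finset.range (m + 1), r (i + j) := by
  rw [Finset.card_eq_sum_ones]
  induction m with
  | zero =>
    rw [sum_segment_zero (fun _ => 1), ← Finset.card_eq_sum_ones, hr]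
    simp
  | succ m ih =>
    rw [sum_segment_succ (fun _ => 1), Finset.prod_range_succ, ← ih (Γ.src _ (Γ.exists_pred _ v).choose)]
    simp_rw [fun u => ih u]
    rw [Finset.sum_const, hr, smul_eq_mul, mul_comm]

end Segment

/-- The pair of two vertices, lifted `m` levels by forming the pair of a vertex with itself. -/
def upLift (i : ℕ) : ∀ m, UP.V i → UP.V i → UP.V (i + m + 1)
  | 0, u, v => upPair i u v
  | m + 1, u, v => upPair (i + m + 1) (upLift i m u v) (upLift i m u v)

/-- Both edges into a diagonal pair come from the same vertex, so each lift just doubles the number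
of paths. -/
theorem sum_start_upLift {i : ℕ} (hi : i ≠ 0) (m : ℕ) (u v : UP.V i) (h : UP.V i → ℕ) :
    ∑ p : UP.Segment i m with p.finish = upLift i m u v, h p.start = 2 ^ m * (h u + h v) := by
  induction m with
  | zero =>
    rw [sum_segment_zero, pow_zero, one_mul]
    exact sum_src_upPair hi u v h
  | succ m ih =>
    rw [sum_segment_succ]
    refine (sum_src_upPair (n := i + m + 1) (Nat.succ_ne_zero _) (upLift i m u v) (upLift i m u v)
      fun w => ∑ p : UP.Segment i m with p.finish = w, h p.start).trans ?_
    rw [ih, pow_succ]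
    ring

theorem le_keptLevel (d : ℕ → ℕ) (k : ℕ) : k ≤ keptLevel d k := by
  induction k with
  | zero => exact le_rfl
  | succ k ih => exact Nat.succ_le_succ (ih.trans (Nat.le_add_right _ _))

theorem isJoin_telescope_UP (d : ℕ → ℕ) {k₀ : ℕ} (hk : k₀ ≠ 0) :
    (UP.telescope d).IsJoin
      (fun k => ∏ j ∈ Finset.range (d k + 1), upInDegree (keptLevel d k + j)) k₀
      (fun k => upLift (keptLevel d k) (d k)) where
  inRegular k v := inRegular_UP.card_segment (keptLevel d k) (d k) v
  sum_src_nat k hk' u v h := by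
    -- Away from level 0 all in-degrees are 2: there are `2 ^ (d k + 1)` paths to the lifted pair,
    -- half of them from each of `u` and `v`.
    have h0 : keptLevel d k ≠ 0 := by have := le_keptLevel d k; omega
    refine (congrArg (2 * ·) (sum_start_upLift h0 (d k) u v h)).trans ?_
    rw [Finset.prod_congr rfl (g := fun _ => 2)
      (fun j _ => upInDegree_of_ne_zero (by omega)), Finset.prod_const, Finset.card_range]
    rw [pow_succ]
    ring

theorem exists_injective_UP {n : ℕ} (hn : 2 ≤ n) : ∃ f : Fin 3 → UP.V n, Function.Injective f := by
  induction n, hn using Nat.le_induction with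
  | base =>
    refine ⟨![(s(false, false) : Sym2 Bool), (s(false, true) : Sym2 Bool),
      (s(true, true) : Sym2 Bool)], ?_⟩
    exact (by decide : Function.Injective ![(s(false, false) : Sym2 Bool),
      (s(false, true) : Sym2 Bool), (s(true, true) : Sym2 Bool)])
  | succ n hn ih =>
    obtain ⟨f, hf⟩ := ih
    obtain ⟨n, rfl⟩ := Nat.exists_eq_succ_of_ne_zero (show n ≠ 0 by omega)
    exact ⟨fun a => upPair (n + 1) (f a) (f a), fun a b hab => hf (Sym2.diag_injective hab)⟩

/-- The kept level of index 2 is at least level 2 of `UP`, the first with three vertices, so three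
labels can be encoded injectively there. -/
theorem exists_not_isStandard_telescope_UP (d : ℕ → ℕ) :
    ∃ μ ∈ Erg (UP.telescope d), ¬ IsStandard μ := by
  obtain ⟨f, hf⟩ := exists_injective_UP (le_keptLevel d 2)
  obtain ⟨base, hbase⟩ := exists_base (Γ := UP.telescope d) 2 f
  exact (isJoin_telescope_UP d two_ne_zero).exists_not_isStandard base (hbase ▸ hf)

end GradedGraph

/-- The graph `UP` is not eventually standard; moreover, ergodicity cannot be recognized on finite
levels: the projection of the set of ergodic central measures to each level is the whole simplex of
probability vectors on the vertices of that level. -/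
theorem mainTheorem8 :
    ¬ UP.EventuallyStandard ∧
      ∀ (n : ℕ) (p : PMF (UP.V n)),
        ∃ μ ∈ GradedGraph.Erg UP, ∀ v : UP.V n, μ {x | x.vert n = v} = p v := by
  refine ⟨fun ⟨d, hd⟩ => ?_, GradedGraph.exists_mem_Erg_UP⟩
  obtain ⟨μ, hμ, hs⟩ := GradedGraph.exists_not_isStandard_telescope_UP d
  exact hs (hd μ hμ)
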